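/- **Theorem (regret of Action Elimination).** *Setting.* There are $K$ arms with parameters $0<\mu_i\le 1$ and $0\le p_1<p_2<\dots<p_K\le 1$. In slot $t$ arm $i$ has an output $X_i(t)\in\{0,1\}$ and a feedback $Y_i(t)\in\{0,1\}$; the pairs $(X_i(t),Y_i(t))$ are independent over all arms and slots, $\mathbb{P}(X_i(t)=1)=\mu_i$ and $\mathbb{P}(Y_i(t)=0\mid X_i(t)=1)=p_i$. In each slot the learner chooses an ordering $\mathcal{L}_t$ of the arms; the first arm in this ordering with output $1$ (if there is one) is shown, and only its identity and its feedback are observed. The expected reward of an ordering $\mathcal{L}=(l_1,\dots,l_K)$ is $r_{\mathcal{L}}=\sum_{j=1}^K(1-p_{l_j})\mu_{l_j}\prod_{k<j}(1-\mu_{l_k})$, and $\mathcal{L}^*=(1,2,\dots,K)$. *Algorithm (horizon $T$).* Let $S_i(t)$ be the number of observations of arm $i$ up to slot $t$, $\hat p_i(t)$ the fraction of these with feedback $0$, and $L_i(t),U_i(t)=\hat p_i(t)\mp\sqrt{2\log T/S_i(t)}$ (with $L_i=-\infty$, $U_i=+\infty$ if $S_i(t)=0$). Initially all arms are active, and $\mathcal{L}_1$,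 which is also the ordered list of active arms, is a random ordering. After each slot $t\le T$ the statistics are updated, and every active arm $j$ with $[L_i(t),U_i(t)]\cap[L_j(t),U_j(t)]=\varnothing$ for all $i\ne j$ is permanently made inactive and deleted from the list of active arms; then the first entry of this list is moved to its end. If more than one arm is still active, $\mathcal{L}_{t+1}$ is the list of active arms followed by the inactive arms in ascending order of $L_i(t)$; otherwise $\mathcal{L}_{t+1}$ lists all arms in ascending order of $L_i(t)$. The initial ordering and the tie-breaking may be random with any joint law, but are independent of the environment $(X_i(t),Y_i(t))_{i,t}$. *Claim.* The regret $\mathcal{R}^{AE}(T)=\sum_{t=1}^T\mathbb{E}\left[r_{\mathcal{L}^*}-r_{\mathcal{L}_t}\right]$ satisfies $$\mathcal{R}^{AE}(T)=O(\log T):$$ there is a constant $C$, depending only on $K$, $(\mu_i)$ and $(p_i)$, such that $|\mathcal{R}^{AE}(T)|\le C\log T$ for all integers $T\ge 2$. -/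

import Mathlib

open MeasureTheory ProbabilityTheory

namespace CascadeBandit

noncomputable section

/-- Orderings of the `K` arms are encoded by permutations when they are drawn at random; every set
of orderings is an event. -/
instance permMeasurableSpace (K : ℕ) : MeasurableSpace (Equiv.Perm (Fin K)) := ⊤

/-- Expected reward of a slot in which the cascade is traversed in the order `l = (l₁, l₂, …)`:
`∑ⱼ (1 - p_{lⱼ}) μ_{lⱼ} ∏_{k < j} (1 - μ_{lₖ})`. -/
def expectedReward {K : ℕ} (μ p : Fin K → ℝ) (l : List (Fin K)) : ℝ :=
  ∑ j : Fin l.length,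
    (1 - p (l.get j)) * μ (l.get j) * ((l.take j).map fun k => 1 - μ k).prod

/-- The stochastic environment. `X t i` is the output of arm `i` in slot `t` and `Y t i` is the
user's feedback on the answer of arm `i` in slot `t`. The pairs `(X t i, Y t i)` are independent
over all slots and arms, `X t i` is Bernoulli with mean `μ i`, and `p i` is the conditional
probability of negative feedback given that the arm outputs one. -/
structure IsEnvironment {Ω : Type*} [MeasurableSpace Ω] (P : Measure Ω) {K : ℕ}
    (μ p : Fin K → ℝ) (X Y : ℕ → Fin K → Ω → Bool) : Prop where
  measurable_output : ∀ t i, Measurable (X t i)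
  measurable_feedback : ∀ t i, Measurable (Y t i)
  indep : iIndepFun (fun (a : ℕ × Fin K) ω => (X a.1 a.2 ω, Y a.1 a.2 ω)) P
  prob_output : ∀ t i, P.real {ω | X t i ω = true} = μ i
  prob_error : ∀ t i, (P[|{ω | X t i ω = true}]).real {ω | Y t i ω = false} = p i

/-- Memory of the Action Elimination algorithm between two slots. -/
structure State (K : ℕ) where
  /-- number of observations of each arm so far -/
  obs : Fin K → ℕ
  /-- number of observed errors of each arm so far -/
  err : Fin K → ℕ
  /-- ordered list of the active arms -/
  active : List (Fin K)
  /-- ordering of all arms that is used in the next slot -/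
  order : List (Fin K)

/-- Confidence radius `√(2 log T / s)` after `s` observations, for horizon `T`. -/
def radius (T s : ℕ) : ℝ := √(2 * Real.log T / s)

/-- Lower confidence bound after `s` observations with `e` errors (`-∞` without observations). -/
def lcb (T s e : ℕ) : EReal := if s = 0 then ⊥ else (((e : ℝ) / s - radius T s : ℝ) : EReal)

/-- Upper confidence bound after `s` observations with `e` errors (`+∞` without observations). -/
def ucb (T s e : ℕ) : EReal := if s = 0 then ⊤ else (((e : ℝ) / s + radius T s : ℝ) : EReal)

open scoped Classical in
/-- All arms in ascending order of the values `L`; ties are broken with the help of `τ`. -/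
def ascending {K : ℕ} (τ : Equiv.Perm (Fin K)) (L : Fin K → EReal) : List (Fin K) :=
  ((List.finRange K).map τ).mergeSort fun i j => decide (L i ≤ L j)

/-- Initially there are no observations, all arms are active, and the order is given by `τ`. -/
def initial {K : ℕ} (τ : Equiv.Perm (Fin K)) : State K where
  obs := fun _ => 0
  err := fun _ => 0
  active := (List.finRange K).map τ
  order := (List.finRange K).map τ

open scoped Classical in
/-- One slot of the Action Elimination algorithm with horizon `T`. Here `x` and `y` are the outputs
and the feedback of the arms in this slot. Only the feedback on the first arm of the current
ordering whose output is one (the arm that is shown) is used. -/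
def step {K : ℕ} (T : ℕ) (τ : Equiv.Perm (Fin K)) (x y : Fin K → Bool) (s : State K) : State K :=
  let shown : Option (Fin K) := s.order.find? x
  let obs' : Fin K → ℕ := fun i => s.obs i + if shown = some i then 1 else 0
  let err' : Fin K → ℕ := fun i => s.err i + if shown = some i ∧ y i = false then 1 else 0
  let L : Fin K → EReal := fun i => lcb T (obs' i) (err' i)
  let U : Fin K → EReal := fun i => ucb T (obs' i) (err' i)
  -- active arms whose confidence interval meets no other one are eliminated
  let remaining : List (Fin K) := s.active.filter fun j =>
    decide (¬ ∀ i, i ≠ j → Disjoint (Set.Icc (L i) (U i)) (Set.Icc (L j) (U j)))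
  -- the remaining list is rotated by one position
  let active' : List (Fin K) := remaining.rotate 1
  { obs := obs'
    err := err'
    active := active'
    order :=
      if 1 < active'.length then
        active' ++ (ascending τ L).filter fun i => decide (i ∉ active')
      else ascending τ L }

/-- State of the algorithm after `n` slots (the slots are numbered `0, 1, 2, …`). The internal
randomness `ξ` provides the initial ordering `ξ 0` and the tie-breaking `ξ (n + 1)` after
slot `n`. -/
def state {K : ℕ} (T : ℕ) (ξ : ℕ → Equiv.Perm (Fin K)) (x y : ℕ → Fin K → Bool) : ℕ → State K
  | 0 => initial (ξ 0)
  | n + 1 => step T (ξ (n + 1)) (x n) (y n) (state T ξ x y n)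

/-- Expected regret of the Action Elimination algorithm with horizon `T` over its `T` slots, with
respect to the ordering `(0, 1, …, K - 1)`, which sorts the arms by increasing `p`. -/
def regret {Ω : Type*} [MeasurableSpace Ω] (P : Measure Ω) {K : ℕ} (μ p : Fin K → ℝ)
    (ξ : ℕ → Ω → Equiv.Perm (Fin K)) (X Y : ℕ → Fin K → Ω → Bool) (T : ℕ) : ℝ :=
  ∑ n ∈ Finset.range T, ∫ ω,
    (expectedReward μ p (List.finRange K) -
      expectedReward μ p
        (state T (fun m => ξ m ω) (fun m i => X m i ω) (fun m i => Y m i ω) n).order) ∂P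

end

end CascadeBandit

namespace CascadeBandit

noncomputable section

/-! ### Expected reward -/

/-! Rewards lie in `[0, 1]`, so the regret is at most the expected number of slots with a suboptimal
ordering. Slots with several active arms and suboptimal slots with at most one are bounded
separately.

Concentration. Which arm is shown depends on the past, but the exponential process of each arm's
error count still has mean at most one (`lintegral_expProcess_le`). A Chernoff bound for each value
of the sample size and a union bound show that all estimates stay within 9/10 of the radius except
with probability `2 * K / T` (`prob_not_typical_le`). The exceptional paths cost at most `2 * K`
slots.

Waiting times. An arm is exposed if only arms with `μ < 1` precede it. It is then shown with
probability at least `hitProb μ j > 0` given the past, so the expected number of slots in which it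
is exposed and has at most `M` observations is at most `(E M + 1) / hitProb μ j`
(`sum_prob_exposed_le`). Each slot to be counted is charged to such an arm.

At most one active arm. A suboptimal ordering puts an exposed arm ahead of a better one. Since the
order follows the lower bounds, the exposed arm has only `O(log T)` observations
(`exists_exposed_obs_le_of_le_one`).

Several active arms. An arm with `μ = 1` can hide an inactive arm forever, and the wide interval of
the hidden arm might keep an active arm alive. But the hidden interval is frozen since its
elimination, when it was disjoint from all others. Once the active arm has 361 times as many
observations as there were slots before the current phase, its interval lies inside its interval of
that time (`exists_obs_le_of_one_lt`). Rotation brings active arms to the head, so the phase with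
`a` active arms has expected length at most a constant times its expected starting time plus `log T`
(`sum_prob_active_length_eq_le`). Descending induction on `a` gives `O(log T)`. -/

theorem expectedReward_nil {K : ℕ} (μ p : Fin K → ℝ) : expectedReward μ p [] = 0 := by
  simp [expectedReward]

theorem expectedReward_cons {K : ℕ} (μ p : Fin K → ℝ) (a : Fin K) (l : List (Fin K)) :
    expectedReward μ p (a :: l) = (1 - p a) * μ a + (1 - μ a) * expectedReward μ p l := by
  simp only [expectedReward]
  rw [show (∑ j : Fin (a :: l).length, (1 - p ((a :: l).get j)) * μ ((a :: l).get j) *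
      (((a :: l).take j).map fun k => 1 - μ k).prod) =
      ∑ j : Fin (l.length + 1), (1 - p ((a :: l).get j)) * μ ((a :: l).get j) *
      (((a :: l).take j).map fun k => 1 - μ k).prod from rfl, Fin.sum_univ_succ, Finset.mul_sum]
  congr 1
  · simp
  · refine Finset.sum_congr rfl fun j _ => ?_
    simp
    ring

theorem expectedReward_mem_Icc {K : ℕ} {μ p : Fin K → ℝ} (hμ : ∀ i, 0 < μ i ∧ μ i ≤ 1)
    (hp : ∀ i, 0 ≤ p i ∧ p i ≤ 1) (l : List (Fin K)) :
    expectedReward μ p l ∈ Set.Icc (0 : ℝ) 1 := by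
  induction l with
  | nil => simp [expectedReward_nil]
  | cons a l ih =>
    rw [expectedReward_cons]
    obtain ⟨h0, h1⟩ := ih
    obtain ⟨m0, m1⟩ := hμ a
    obtain ⟨p0, p1⟩ := hp a
    constructor
    · have := mul_nonneg (sub_nonneg.2 p1) m0.le
      have := mul_nonneg (sub_nonneg.2 m1) h0
      linarith
    · nlinarith [mul_nonneg p0 m0.le, mul_nonneg (sub_nonneg.2 m1) (sub_nonneg.2 h1)]

/-- Arm `j` is reached with positive probability when the arms are traversed in the order `l`. -/
def Exposed {K : ℕ} (μ : Fin K → ℝ) (l : List (Fin K)) (j : Fin K) : Prop :=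
  ∃ l₁ l₂, l = l₁ ++ j :: l₂ ∧ ∀ k ∈ l₁, μ k < 1

theorem Exposed.mem {K : ℕ} {μ : Fin K → ℝ} {l : List (Fin K)} {j : Fin K}
    (h : Exposed μ l j) : j ∈ l := by
  obtain ⟨l₁, l₂, rfl, -⟩ := h
  simp

theorem exposed_head {K : ℕ} (μ : Fin K → ℝ) (a : Fin K) (l : List (Fin K)) :
    Exposed μ (a :: l) a :=
  ⟨[], l, rfl, by simp⟩

theorem Exposed.cons {K : ℕ} {μ : Fin K → ℝ} {l : List (Fin K)} {a j : Fin K}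
    (h : Exposed μ l j) (ha : μ a < 1) : Exposed μ (a :: l) j := by
  obtain ⟨l₁, l₂, rfl, h⟩ := h
  exact ⟨a :: l₁, l₂, rfl, by simpa [ha] using h⟩

/-- An arm that is not exposed comes after an exposed arm that always has an output. -/
theorem exists_blocking {K : ℕ} {μ : Fin K → ℝ} (hμ : ∀ i, μ i ≤ 1) {l : List (Fin K)}
    {i : Fin K} (hi : i ∈ l) (h : ¬ Exposed μ l i) :
    ∃ m, [m, i].Sublist l ∧ μ m = 1 ∧ Exposed μ l m := by
  induction l with
  | nil => simp at hi
  | cons a l ih =>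
    have hia : i ≠ a := by
      rintro rfl
      exact h (exposed_head _ _ _)
    have hil : i ∈ l := by simpa [hia] using hi
    by_cases ha : μ a < 1
    · obtain ⟨m, hm, h1, hE⟩ := ih hil fun h' => h (h'.cons ha)
      exact ⟨m, hm.cons _, h1, hE.cons ha⟩
    · exact ⟨a, (List.singleton_sublist.2 hil).cons_cons a, le_antisymm (hμ a) (not_lt.1 ha),
        exposed_head _ _ _⟩

/-- The head is always exposed, so it must be the minimum. If its output is certain, the factor `1 -
μ a` removes the rest of the reward and the order behind it is irrelevant; this is why only
inversions starting at an exposed arm have to be excluded. -/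
theorem expectedReward_eq_of_sorted {K : ℕ} (μ p : Fin K → ℝ) (l l' : List (Fin K))
    (hll : l.Perm l') (hl' : l'.Pairwise (· < ·))
    (h : ∀ j i, Exposed μ l j → [j, i].Sublist l → j < i) (hμ : ∀ i, μ i ≤ 1) :
    expectedReward μ p l = expectedReward μ p l' := by
  induction l generalizing l' with
  | nil => rw [List.nil_perm.1 hll]
  | cons a l ih =>
    cases l' with
    | nil => simp at hll
    | cons b l' =>
      have hab : a = b := by
        by_contra hne
        have hb : b ∈ l := by
          have : b ∈ a :: l := hll.mem_iff.2 (by simp)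
          simpa [Ne.symm hne] using this
        have ha : a ∈ l' := by
          have : a ∈ b :: l' := hll.mem_iff.1 (by simp)
          simpa [hne] using this
        have h1 := h a b (exposed_head _ _ _) ((List.singleton_sublist.2 hb).cons_cons a)
        have h2 := (List.pairwise_cons.1 hl').1 a ha
        exact absurd (h1.trans h2) (lt_irrefl _)
      subst hab
      rw [expectedReward_cons, expectedReward_cons]
      by_cases ha : μ a < 1
      · rw [ih l' (List.perm_cons _ |>.1 hll) (List.pairwise_cons.1 hl').2
          fun j i hj hji => h j i (hj.cons ha) (hji.cons _)]
      · rw [le_antisymm (hμ a) (not_lt.1 ha)]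
        ring

/-- If an ordering is suboptimal, then an exposed arm precedes a better one. -/
theorem exists_exposed_of_expectedReward_ne {K : ℕ} {μ p : Fin K → ℝ} (hμ : ∀ i, μ i ≤ 1)
    {l : List (Fin K)} (hl : l.Perm (List.finRange K))
    (h : expectedReward μ p (List.finRange K) - expectedReward μ p l ≠ 0) :
    ∃ j i, Exposed μ l j ∧ [j, i].Sublist l ∧ i < j := by
  by_contra! hcon
  refine h (sub_eq_zero.2 (expectedReward_eq_of_sorted μ p l _ hl
    (List.pairwise_lt_finRange K) (fun j i hj hji => ?_) hμ).symm)
  refine lt_of_le_of_ne (hcon j i hj hji) ?_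
  rintro rfl
  have := (hl.nodup_iff.2 (List.nodup_finRange K)).sublist hji
  simp at this

/-! ### One slot of the algorithm -/

/-- The confidence interval of arm `i`. -/
def interval {K : ℕ} (T : ℕ) (s : State K) (i : Fin K) : Set EReal :=
  Set.Icc (lcb T (s.obs i) (s.err i)) (ucb T (s.obs i) (s.err i))

theorem ascending_perm {K : ℕ} (τ : Equiv.Perm (Fin K)) (L : Fin K → EReal) :
    (ascending τ L).Perm (List.finRange K) := by
  unfold ascending
  refine (List.mergeSort_perm _ _).trans ?_
  rw [List.perm_ext_iff_of_nodup ((List.nodup_finRange K).map τ.injective) (List.nodup_finRange K)]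
  intro a
  simpa using ⟨τ.symm a, by simp⟩

theorem ascending_pairwise {K : ℕ} (τ : Equiv.Perm (Fin K)) (L : Fin K → EReal) :
    (ascending τ L).Pairwise fun i j => L i ≤ L j := by
  classical
  unfold ascending
  have := List.pairwise_mergeSort (le := fun i j => decide (L i ≤ L j))
    (fun a b c => by simpa using fun h1 h2 => le_trans h1 h2)
    (fun a b => by simpa using le_total (L a) (L b)) ((List.finRange K).map τ)
  refine List.Pairwise.imp ?_ ?_ (R := fun i j => decide (L i ≤ L j) = true)
  · intro a b; simp
  · convert this

section Step

variable {K : ℕ} (T : ℕ) (τ : Equiv.Perm (Fin K)) (x y : Fin K → Bool) (s : State K)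

theorem mem_step_active (j : Fin K) :
    j ∈ (step T τ x y s).active ↔ j ∈ s.active ∧
      ¬ ∀ i, i ≠ j → Disjoint (interval T (step T τ x y s) i)
        (interval T (step T τ x y s) j) := by
  simp [step, interval]

theorem exists_step_active_eq_rotate_filter :
    ∃ f : Fin K → Bool, (step T τ x y s).active = (s.active.filter f).rotate 1 :=
  ⟨_, rfl⟩

theorem step_order :
    (1 < (step T τ x y s).active.length ∧ ∃ rest,
      (step T τ x y s).order = (step T τ x y s).active ++ rest ∧
      rest.Pairwise (fun i j => lcb T ((step T τ x y s).obs i) ((step T τ x y s).err i) ≤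
        lcb T ((step T τ x y s).obs j) ((step T τ x y s).err j)) ∧
      rest.Nodup ∧ ∀ i, i ∈ rest ↔ i ∉ (step T τ x y s).active) ∨
    ((step T τ x y s).active.length ≤ 1 ∧
      (step T τ x y s).order.Perm (List.finRange K) ∧
      (step T τ x y s).order.Pairwise
        (fun i j => lcb T ((step T τ x y s).obs i) ((step T τ x y s).err i) ≤
        lcb T ((step T τ x y s).obs j) ((step T τ x y s).err j))) := by
  classical
  have ho : (step T τ x y s).order = if 1 < (step T τ x y s).active.length then
      (step T τ x y s).active ++ (ascending τ fun i => lcb T ((step T τ x y s).obs i)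
        ((step T τ x y s).err i)).filter fun i => decide (i ∉ (step T τ x y s).active)
      else ascending τ fun i => lcb T ((step T τ x y s).obs i) ((step T τ x y s).err i) := by
    simp only [step]
  have hperm := ascending_perm τ fun i => lcb T ((step T τ x y s).obs i) ((step T τ x y s).err i)
  have hpw := ascending_pairwise τ fun i => lcb T ((step T τ x y s).obs i)
    ((step T τ x y s).err i)
  by_cases h : 1 < (step T τ x y s).active.length
  · left
    rw [if_pos h] at ho
    refine ⟨h, _, ho, hpw.filter _, (hperm.nodup_iff.2 (List.nodup_finRange K)).filter _, ?_⟩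
    intro i
    simp [hperm.mem_iff]
  · right
    rw [if_neg h] at ho
    rw [ho]
    exact ⟨not_lt.1 h, hperm, hpw⟩

end Step

/-! ### Sample paths -/

section Path

variable {K : ℕ} {T : ℕ} {ξ : ℕ → Equiv.Perm (Fin K)} {x y : ℕ → Fin K → Bool}

theorem obs_succ (n : ℕ) (i : Fin K) :
    (state T ξ x y (n + 1)).obs i = (state T ξ x y n).obs i +
      if (state T ξ x y n).order.find? (x n) = some i then 1 else 0 := rfl

theorem err_succ (n : ℕ) (i : Fin K) :
    (state T ξ x y (n + 1)).err i = (state T ξ x y n).err i +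
      if (state T ξ x y n).order.find? (x n) = some i ∧ y n i = false then 1 else 0 := rfl

theorem obs_mono (i : Fin K) : Monotone fun n => (state T ξ x y n).obs i :=
  monotone_nat_of_le_succ fun n => by rw [obs_succ]; omega

theorem obs_le (n : ℕ) (i : Fin K) : (state T ξ x y n).obs i ≤ n := by
  induction n with
  | zero => exact le_rfl
  | succ n ih => rw [obs_succ]; split_ifs <;> omega

theorem exists_active_succ_eq (n : ℕ) : ∃ f : Fin K → Bool,
    (state T ξ x y (n + 1)).active = ((state T ξ x y n).active.filter f).rotate 1 :=
  exists_step_active_eq_rotate_filter _ _ _ _ _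

theorem mem_active_zero (i : Fin K) : i ∈ (state T ξ x y 0).active := by
  simpa [state, initial] using ⟨(ξ 0).symm i, by simp⟩

theorem active_nodup (n : ℕ) : (state T ξ x y n).active.Nodup := by
  induction n with
  | zero => exact (List.nodup_finRange K).map (ξ 0).injective
  | succ n ih =>
    obtain ⟨f, hf⟩ := exists_active_succ_eq (T := T) (ξ := ξ) (x := x) (y := y) n
    rw [hf, List.nodup_rotate]
    exact ih.filter _

theorem mem_active_succ (n : ℕ) (j : Fin K) :
    j ∈ (state T ξ x y (n + 1)).active ↔ j ∈ (state T ξ x y n).active ∧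
      ¬ ∀ i, i ≠ j → Disjoint (interval T (state T ξ x y (n + 1)) i)
        (interval T (state T ξ x y (n + 1)) j) :=
  mem_step_active _ _ _ _ _ _

theorem mem_active_of_le {m n : ℕ} (h : m ≤ n) {j : Fin K}
    (hj : j ∈ (state T ξ x y n).active) : j ∈ (state T ξ x y m).active := by
  induction n, h using Nat.le_induction with
  | base => exact hj
  | succ n _ ih => exact ih ((mem_active_succ n j).1 hj).1

theorem active_length_antitone : Antitone fun n => (state T ξ x y n).active.length := by
  refine antitone_nat_of_succ_le fun n => ?_
  obtain ⟨f, hf⟩ := exists_active_succ_eq (T := T) (ξ := ξ) (x := x) (y := y) n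
  rw [hf, List.length_rotate]
  exact List.length_filter_le _ _

theorem active_length_le (n : ℕ) : (state T ξ x y n).active.length ≤ K :=
  (active_length_antitone (Nat.zero_le n)).trans (by simp [state, initial])

theorem active_length_succ_lt {n : ℕ} {i : Fin K} (hi : i ∈ (state T ξ x y n).active)
    (hi' : i ∉ (state T ξ x y (n + 1)).active) :
    (state T ξ x y (n + 1)).active.length < (state T ξ x y n).active.length := by
  obtain ⟨f, hf⟩ := exists_active_succ_eq (T := T) (ξ := ξ) (x := x) (y := y) n
  rw [hf] at hi' ⊢
  rw [List.length_rotate]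
  refine List.length_filter_lt_length_iff_exists.2 ⟨i, hi, fun h => hi' ?_⟩
  simp [hi, h]

theorem active_succ_eq_rotate {n : ℕ} (h : (state T ξ x y (n + 1)).active.length =
    (state T ξ x y n).active.length) :
    (state T ξ x y (n + 1)).active = (state T ξ x y n).active.rotate 1 := by
  obtain ⟨f, hf⟩ := exists_active_succ_eq (T := T) (ξ := ξ) (x := x) (y := y) n
  rw [hf, List.length_rotate] at h
  rw [hf, List.filter_eq_self.2 (List.length_filter_eq_length_iff.1 h)]

theorem active_add_eq_rotate {n d : ℕ} (h : (state T ξ x y (n + d)).active.length =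
    (state T ξ x y n).active.length) :
    (state T ξ x y (n + d)).active = (state T ξ x y n).active.rotate d := by
  induction d with
  | zero => simp
  | succ d ih =>
    have h1 := active_length_antitone (T := T) (ξ := ξ) (x := x) (y := y) (Nat.le_add_right n d)
    have h2 := active_length_antitone (T := T) (ξ := ξ) (x := x) (y := y) (Nat.le_succ (n + d))
    have h3 : (state T ξ x y (n + d)).active.length = (state T ξ x y n).active.length :=
      le_antisymm h1 (h ▸ h2)
    have := active_succ_eq_rotate (T := T) (ξ := ξ) (x := x) (y := y) (n := n + d)
      (by rw [h3]; exact h)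
    rw [← add_assoc, this, ih h3, List.rotate_rotate]

/-- If no arm is eliminated for long enough, then every active arm has recently been the first
one. -/
theorem exists_eq_cons_active {m n : ℕ} (hmn : m + K ≤ n)
    (h : (state T ξ x y n).active.length = (state T ξ x y m).active.length) {j : Fin K}
    (hj : j ∈ (state T ξ x y n).active) :
    ∃ d, d < K ∧ d ≤ n ∧ (state T ξ x y (n - d)).active.length =
      (state T ξ x y n).active.length ∧ ∃ l, (state T ξ x y (n - d)).active = j :: l := by
  have hK : 0 < K := j.pos
  obtain ⟨q, hq⟩ : ∃ q, n = m + K + q := ⟨n - (m + K), by omega⟩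
  have hlen : ∀ d, d ≤ K → (state T ξ x y (n - d)).active.length =
      (state T ξ x y n).active.length := fun d hd =>
    le_antisymm (h ▸ active_length_antitone (by omega)) (active_length_antitone (by omega))
  set a := (state T ξ x y n).active.length with ha
  have haK : a ≤ K := active_length_le n
  -- Go back `K - 1` slots. Without eliminations the list only rotates, so an arm at position `e <
  -- K` there reaches the head `e` slots later.
  have hrot := active_add_eq_rotate (T := T) (ξ := ξ) (x := x) (y := y) (n := n - (K - 1))
    (d := K - 1) (by rw [Nat.sub_add_cancel (by omega)]; exact (hlen _ (by omega)).symm)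
  rw [Nat.sub_add_cancel (by omega)] at hrot
  set l₀ := (state T ξ x y (n - (K - 1))).active with hl₀
  have hl₀a : l₀.length = a := hlen _ (by omega)
  have hj0 : j ∈ l₀ := by rw [hrot] at hj; simpa using hj
  obtain ⟨e, he, hej⟩ := List.getElem_of_mem hj0
  refine ⟨K - 1 - e, by omega, by omega, hlen _ (by omega), ?_⟩
  have hrot' := active_add_eq_rotate (T := T) (ξ := ξ) (x := x) (y := y) (n := n - (K - 1))
    (d := e) (by rw [show n - (K - 1) + e = n - (K - 1 - e) by omega, hlen _ (by omega),
      hlen _ (by omega)])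
  rw [show n - (K - 1) + e = n - (K - 1 - e) by omega] at hrot'
  rw [hrot', ← hl₀, List.rotate_eq_drop_append_take he.le, List.drop_eq_getElem_cons he, hej]
  exact ⟨_, rfl⟩

/-- While several arms are active, they come first; the other ones are sorted by their lower
confidence bounds. -/
theorem order_of_one_lt {n : ℕ} (h : 1 < (state T ξ x y n).active.length) : ∃ rest,
    (state T ξ x y n).order = (state T ξ x y n).active ++ rest ∧
    rest.Pairwise (fun i j => lcb T ((state T ξ x y n).obs i) ((state T ξ x y n).err i) ≤
      lcb T ((state T ξ x y n).obs j) ((state T ξ x y n).err j)) ∧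
    rest.Nodup ∧ ∀ i, i ∈ rest ↔ i ∉ (state T ξ x y n).active := by
  cases n with
  | zero =>
    refine ⟨[], by simp [state, initial], by simp, by simp, fun i => ?_⟩
    simp [mem_active_zero]
  | succ n =>
    rcases step_order T (ξ (n + 1)) (x n) (y n) (state T ξ x y n) with ⟨_, h'⟩ | ⟨h', _⟩
    · exact h'
    · exact absurd h (not_lt.2 h')

theorem order_of_le_one {n : ℕ} (h : (state T ξ x y n).active.length ≤ 1) :
    (state T ξ x y n).order.Pairwise (fun i j =>
      lcb T ((state T ξ x y n).obs i) ((state T ξ x y n).err i) ≤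
      lcb T ((state T ξ x y n).obs j) ((state T ξ x y n).err j)) := by
  cases n with
  | zero => exact List.pairwise_of_forall fun i j => by simp [state, initial]
  | succ n =>
    rcases step_order T (ξ (n + 1)) (x n) (y n) (state T ξ x y n) with ⟨h', _⟩ | ⟨_, _, h'⟩
    · exact absurd h' (not_lt.2 h)
    · exact h'

theorem order_perm (n : ℕ) : (state T ξ x y n).order.Perm (List.finRange K) := by
  by_cases h : 1 < (state T ξ x y n).active.length
  · obtain ⟨rest, ho, -, hnd, hmem⟩ := order_of_one_lt h
    rw [ho, List.perm_ext_iff_of_nodup _ (List.nodup_finRange K)]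
    · intro i
      simp [hmem, em]
    · refine (active_nodup n).append hnd fun i hi hi' => (hmem i).1 hi' hi
  · cases n with
    | zero =>
      simp only [state, initial]
      rw [List.perm_ext_iff_of_nodup ((List.nodup_finRange K).map (ξ 0).injective)
        (List.nodup_finRange K)]
      intro i
      simpa using ⟨(ξ 0).symm i, by simp⟩
    | succ n =>
      rcases step_order T (ξ (n + 1)) (x n) (y n) (state T ξ x y n) with ⟨h', _⟩ | ⟨_, h', _⟩
      · exact absurd h' h
      · exact h'

theorem mem_order (n : ℕ) (i : Fin K) : i ∈ (state T ξ x y n).order :=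
  (order_perm n).mem_iff.2 (List.mem_finRange i)

theorem order_nodup (n : ℕ) : (state T ξ x y n).order.Nodup :=
  (order_perm n).nodup_iff.2 (List.nodup_finRange K)

/-- The number of slots before slot `n` with more than `a` active arms. -/
def slotsAbove (s : ℕ → State K) (a n : ℕ) : ℕ :=
  ((Finset.range n).filter fun m => a < (s m).active.length).card

/-- The number of active arms never increases, so the slots counted by `slotsAbove` form an initial
segment of time: the count is the time at which at most `a` arms are left, cut off at `n`. -/
theorem le_slotsAbove {n t a : ℕ} (ht : a < (state T ξ x y t).active.length)
    (htn' : t < n) : t + 1 ≤ slotsAbove (state T ξ x y) a n := by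
  rw [← Finset.card_range (t + 1)]
  refine Finset.card_le_card fun m hm => ?_
  simp only [Finset.mem_range, Finset.mem_filter] at hm ⊢
  exact ⟨by omega, ht.trans_le (active_length_antitone (by omega : m ≤ t))⟩

/-- Once at most `a` arms are active the count is final. It is then known from the past alone, yet
agrees with its value at the horizon. -/
theorem slotsAbove_eq_of_length_le {n N a : ℕ} (hn : n ≤ N)
    (h : (state T ξ x y n).active.length ≤ a) :
    slotsAbove (state T ξ x y) a n = slotsAbove (state T ξ x y) a N := by
  unfold slotsAbove
  congr 1
  ext m
  simp only [Finset.mem_range, Finset.mem_filter]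
  refine ⟨fun hm => ⟨by omega, hm.2⟩, fun hm => ⟨?_, hm.2⟩⟩
  by_contra hmn
  have := active_length_antitone (T := T) (ξ := ξ) (x := x) (y := y) (not_lt.1 hmn)
  exact absurd hm.2 (not_lt.2 (this.trans h))

theorem slotsAbove_lt {n a : ℕ} (h : (state T ξ x y n).active.length = a)
    (hn : slotsAbove (state T ξ x y) a n < n) :
    (state T ξ x y (slotsAbove (state T ξ x y) a n)).active.length = a := by
  set σ := slotsAbove (state T ξ x y) a n with hσ
  refine le_antisymm ?_ (h ▸ active_length_antitone hn.le)
  by_contra hcon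
  have := le_slotsAbove (not_le.1 hcon) hn
  omega

/-- An inactive arm was eliminated at some time. -/
theorem exists_eliminated {n : ℕ} {i : Fin K} (hi : i ∉ (state T ξ x y n).active) :
    ∃ t < n, i ∈ (state T ξ x y t).active ∧ i ∉ (state T ξ x y (t + 1)).active := by
  induction n with
  | zero => exact absurd (mem_active_zero i) hi
  | succ n ih =>
    by_cases h : i ∈ (state T ξ x y n).active
    · exact ⟨n, by omega, h, hi⟩
    · obtain ⟨t, ht, h'⟩ := ih h
      exact ⟨t, by omega, h'⟩

theorem disjoint_of_eliminated {t : ℕ} {i : Fin K} (hi : i ∈ (state T ξ x y t).active)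
    (hi' : i ∉ (state T ξ x y (t + 1)).active) (k : Fin K) (hk : k ≠ i) :
    Disjoint (interval T (state T ξ x y (t + 1)) k) (interval T (state T ξ x y (t + 1)) i) := by
  rw [mem_active_succ] at hi'
  have := not_not.1 fun h => hi' ⟨hi, h⟩
  exact this k hk

theorem find?_order_ne_of_active {n : ℕ} (h : 1 < (state T ξ x y n).active.length) {m i : Fin K}
    (hm : m ∈ (state T ξ x y n).active) (hx : x n m = true)
    (hi : i ∉ (state T ξ x y n).active) :
    (state T ξ x y n).order.find? (x n) ≠ some i := by
  obtain ⟨rest, ho, -⟩ := order_of_one_lt h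
  rw [ho, List.find?_append]
  cases hf : (state T ξ x y n).active.find? (x n) with
  | none => exact absurd hx (List.find?_eq_none.1 hf m hm)
  | some b =>
    intro h
    have : b = i := by simpa using h
    exact hi (this ▸ List.mem_of_find?_eq_some hf)

theorem find?_ne_of_pairwise {α : Type*} {R : α → α → Prop} {l : List α} (hl : l.Pairwise R)
    {q : α → Bool} {m i : α} (hm : m ∈ l) (hq : q m = true) (hmi : m ≠ i) (hR : ¬ R i m) :
    l.find? q ≠ some i := by
  intro h
  obtain ⟨-, as, bs, rfl, has⟩ := List.find?_eq_some_iff_append.1 h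
  have hm' : m ∈ bs := by
    rcases List.mem_append.1 hm with hm | hm
    · have := has m hm
      simp [hq] at this
    · simpa [hmi] using hm
  exact hR ((List.pairwise_cons.1 (List.pairwise_append.1 hl).2.1).1 m hm')

theorem find?_order_ne_of_lcb {n : ℕ} (h : 1 < (state T ξ x y n).active.length) {m i : Fin K}
    (hm : m ∉ (state T ξ x y n).active) (hx : x n m = true)
    (hi : i ∉ (state T ξ x y n).active)
    (hL : lcb T ((state T ξ x y n).obs m) ((state T ξ x y n).err m) <
      lcb T ((state T ξ x y n).obs i) ((state T ξ x y n).err i)) :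
    (state T ξ x y n).order.find? (x n) ≠ some i := by
  obtain ⟨rest, ho, hpw, -, hmem⟩ := order_of_one_lt h
  rw [ho, List.find?_append]
  cases hf : (state T ξ x y n).active.find? (x n) with
  | none =>
    rw [Option.none_or]
    refine find?_ne_of_pairwise hpw ((hmem m).2 hm) hx ?_ (not_le.2 hL)
    rintro rfl
    exact lt_irrefl _ hL
  | some b =>
    intro h
    have : b = i := by simpa using h
    exact hi (this ▸ List.mem_of_find?_eq_some hf)

theorem find?_order_of_exposed {μ : Fin K → ℝ} {n : ℕ} {j : Fin K}
    (hj : Exposed μ (state T ξ x y n).order j) (hxj : x n j = true)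
    (hx : ∀ k, k ≠ j → μ k < 1 → x n k = false) :
    (state T ξ x y n).order.find? (x n) = some j := by
  obtain ⟨l₁, l₂, ho, hl₁⟩ := hj
  have hnd := order_nodup (T := T) (ξ := ξ) (x := x) (y := y) n
  rw [List.find?_eq_some_iff_append]
  refine ⟨hxj, l₁, l₂, ho, fun a ha => ?_⟩
  rw [hx a _ (hl₁ a ha)]
  · rfl
  · rintro rfl
    rw [ho, List.nodup_append] at hnd
    exact hnd.2.2 a ha a (by simp) rfl

/-- An arm is shown at most `M + 1` times while it has at most `M` observations. -/
theorem card_shown_le (j : Fin K) {M : ℝ} (hM : 0 ≤ M) (A : Finset ℕ)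
    (hA : ∀ n ∈ A, (state T ξ x y n).order.find? (x n) = some j ∧
      ((state T ξ x y n).obs j : ℝ) ≤ M) : (A.card : ℝ) ≤ M + 1 := by
  -- Every showing raises the count, so the counts at the slots of `A` are distinct integers in `[0,
  -- M]`.
  have hinj : Set.InjOn (fun n => (state T ξ x y n).obs j) A := by
    have key : ∀ m ∈ A, ∀ n, m < n → (state T ξ x y m).obs j < (state T ξ x y n).obs j := by
      intro m hm n hmn
      have h1 : (state T ξ x y (m + 1)).obs j = (state T ξ x y m).obs j + 1 := by
        rw [obs_succ, if_pos (hA m hm).1]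
      have h2 := obs_mono (T := T) (ξ := ξ) (x := x) (y := y) j (show m + 1 ≤ n from hmn)
      simp only at h2
      omega
    intro m hm n hn hmn
    simp only at hmn
    rcases lt_trichotomy m n with h | h | h
    · exact absurd hmn (key m hm n h).ne
    · exact h
    · exact absurd hmn (key n hn m h).ne'
  have hcard : A.card ≤ (Finset.range (⌊M⌋₊ + 1)).card := by
    refine Finset.card_le_card_of_injOn _ (fun n hn => ?_) hinj
    simp only [Finset.coe_range, Set.mem_Iio]
    exact Nat.lt_succ_of_le (Nat.le_floor (hA n hn).2)
  rw [Finset.card_range] at hcard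
  have := Nat.floor_le hM
  have h3 : (A.card : ℝ) ≤ ⌊M⌋₊ + 1 := by exact_mod_cast hcard
  linarith

end Path

/-! ### Confidence intervals -/

theorem radius_nonneg (T s : ℕ) : 0 ≤ radius T s := Real.sqrt_nonneg _

theorem radius_le_of_le {T s : ℕ} {Δ : ℝ} (hΔ : 0 < Δ) (hs : 0 < s)
    (h : 32 / Δ ^ 2 * Real.log T ≤ s) : radius T s ≤ Δ / 4 := by
  have hs' : (0 : ℝ) < s := by exact_mod_cast hs
  refine Real.sqrt_le_iff.2 ⟨by positivity, ?_⟩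
  rw [div_le_iff₀ hs']
  have : 32 / Δ ^ 2 * Real.log T * (Δ ^ 2 / 16) ≤ s * (Δ ^ 2 / 16) :=
    mul_le_mul_of_nonneg_right h (by positivity)
  have h2 : 32 / Δ ^ 2 * Real.log T * (Δ ^ 2 / 16) = 2 * Real.log T := by
    field_simp
    ring
  nlinarith

/-- The radius scales like `1 / √s`, and `361 = 19 ^ 2`. The 19 is the ratio of the outer margin
19/10 to the inner margin 1/10 of an accurate interval. -/
theorem mul_radius_le {T s s' : ℕ} (hs : 0 < s) (h : 361 * s ≤ s') :
    19 * radius T s' ≤ radius T s := by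
  have hs' : (0 : ℝ) < s := by exact_mod_cast hs
  have h' : (361 : ℝ) * s ≤ s' := by exact_mod_cast h
  have hlog : 0 ≤ Real.log T := Real.log_natCast_nonneg T
  refine Real.le_sqrt_of_sq_le ?_
  rw [mul_pow, radius, Real.sq_sqrt (by positivity), ← mul_div_assoc,
    div_le_div_iff₀ (by linarith) hs']
  nlinarith

/-- The empirical error rate of arm `i` is closer to `p i` than the confidence radius. -/
def Accurate {K : ℕ} (p : Fin K → ℝ) (T : ℕ) (s : State K) (i : Fin K) : Prop :=
  0 < s.obs i → |(s.err i : ℝ) / s.obs i - p i| ≤ 9 / 10 * radius T (s.obs i)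

section Accurate

variable {K T : ℕ} {p : Fin K → ℝ} {s : State K} {i : Fin K}

theorem Accurate.lcb_le (h : Accurate p T s i) : lcb T (s.obs i) (s.err i) ≤ (p i : EReal) := by
  unfold lcb
  split_ifs with h0
  · exact bot_le
  · have := abs_le.1 (h (Nat.pos_of_ne_zero h0))
    have hr := radius_nonneg T (s.obs i)
    exact EReal.coe_le_coe_iff.2 (by linarith)

theorem Accurate.le_lcb (h : Accurate p T s i) (h0 : 0 < s.obs i) :
    ((p i - 19 / 10 * radius T (s.obs i) : ℝ) : EReal) ≤ lcb T (s.obs i) (s.err i) := by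
  unfold lcb
  rw [if_neg h0.ne']
  have := abs_le.1 (h h0)
  exact EReal.coe_le_coe_iff.2 (by linarith)

theorem Accurate.ucb_le (h : Accurate p T s i) (h0 : 0 < s.obs i) :
    ucb T (s.obs i) (s.err i) ≤ ((p i + 19 / 10 * radius T (s.obs i) : ℝ) : EReal) := by
  unfold ucb
  rw [if_neg h0.ne']
  have := abs_le.1 (h h0)
  exact EReal.coe_le_coe_iff.2 (by linarith)

theorem Accurate.interval_subset (h : Accurate p T s i) (h0 : 0 < s.obs i) :
    interval T s i ⊆ Set.Icc ((p i - 19 / 10 * radius T (s.obs i) : ℝ) : EReal)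
      ((p i + 19 / 10 * radius T (s.obs i) : ℝ) : EReal) :=
  Set.Icc_subset_Icc (h.le_lcb h0) (h.ucb_le h0)

/-- This is the use of accuracy up to 9/10 of the radius rather than the full radius: a
neighbourhood of `p i` of definite size stays inside the interval. -/
theorem Accurate.subset_interval (h : Accurate p T s i) (h0 : 0 < s.obs i) :
    Set.Icc ((p i - 1 / 10 * radius T (s.obs i) : ℝ) : EReal)
      ((p i + 1 / 10 * radius T (s.obs i) : ℝ) : EReal) ⊆ interval T s i := by
  unfold interval lcb ucb
  rw [if_neg h0.ne', if_neg h0.ne']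
  have := abs_le.1 (h h0)
  exact Set.Icc_subset_Icc (EReal.coe_le_coe_iff.2 (by linarith))
    (EReal.coe_le_coe_iff.2 (by linarith))

theorem interval_eq_univ (h0 : s.obs i = 0) : interval T s i = Set.univ := by
  simp [interval, lcb, ucb, h0]

theorem Accurate.mem_interval (h : Accurate p T s i) : (p i : EReal) ∈ interval T s i := by
  rcases Nat.eq_zero_or_pos (s.obs i) with h0 | h0
  · rw [interval_eq_univ h0]; trivial
  · have := radius_nonneg T (s.obs i)
    exact h.subset_interval h0 ⟨EReal.coe_le_coe_iff.2 (by linarith),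
      EReal.coe_le_coe_iff.2 (by linarith)⟩

/-- Each interval reaches at most `19 / 10 * (Δ / 4)` away from its parameter, and twice this is `19
/ 20 * Δ < Δ`. -/
theorem Accurate.disjoint {j : Fin K} {Δ : ℝ} (hi : Accurate p T s i) (hj : Accurate p T s j)
    (hi0 : 0 < s.obs i) (hj0 : 0 < s.obs j) (hΔ : 0 < Δ) (hij : Δ ≤ |p i - p j|)
    (hri : radius T (s.obs i) ≤ Δ / 4) (hrj : radius T (s.obs j) ≤ Δ / 4) :
    Disjoint (interval T s i) (interval T s j) := by
  rw [Set.disjoint_left]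
  intro z hzi hzj
  have h1 := hi.interval_subset hi0 hzi
  have h2 := hj.interval_subset hj0 hzj
  have h3 := EReal.coe_le_coe_iff.1 (h1.1.trans h2.2)
  have h4 := EReal.coe_le_coe_iff.1 (h2.1.trans h1.2)
  have : |p i - p j| ≤ 19 / 20 * Δ := abs_le.2 ⟨by linarith, by linarith⟩
  linarith

/-- If the confidence intervals of two arms are disjoint, their order is the right one. -/
theorem Accurate.lt_lcb {m : Fin K} (hi : Accurate p T s i) (hm : Accurate p T s m)
    (hmi : p m < p i) (hd : Disjoint (interval T s m) (interval T s i)) :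
    (p m : EReal) < lcb T (s.obs i) (s.err i) := by
  -- Otherwise `p m` lies in both intervals: above the lower bound of `i`, and below `p i`, hence
  -- below its upper bound.
  by_contra hcon
  exact Set.disjoint_left.1 hd hm.mem_interval ⟨not_lt.1 hcon,
    (EReal.coe_le_coe_iff.2 hmi.le).trans hi.mem_interval.2⟩

end Accurate

/-! ### Typical sample paths -/

/-- Sample paths on which all estimates are accurate, and arms with `μ i = 1` have outputs. -/
structure Typical {K : ℕ} (μ p : Fin K → ℝ) (T : ℕ) (ξ : ℕ → Equiv.Perm (Fin K))
    (x y : ℕ → Fin K → Bool) : Prop where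
  accurate : ∀ n < T, ∀ i, Accurate p T (state T ξ x y n) i
  output : ∀ n < T, ∀ i, μ i = 1 → x n i = true

section Typical

variable {K : ℕ} {μ p : Fin K → ℝ} {T : ℕ} {ξ : ℕ → Equiv.Perm (Fin K)}
  {x y : ℕ → Fin K → Bool}

/-- Arm `m` always has an output and stays ahead of `i`. While active it precedes all inactive arms.
Once inactive it is sorted ahead, because its lower bound is at most `p m`, while that of `i`,
unchanged by induction, exceeds `p m` by disjointness at slot `t`. -/
theorem state_eq_of_blocked (h : Typical μ p T ξ x y) {n t : ℕ} (hn : n < T) (htn : t ≤ n)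
    (hlen : 1 < (state T ξ x y n).active.length) {i m : Fin K}
    (hi : i ∉ (state T ξ x y t).active) (hμ : μ m = 1)
    (hm : m ∈ (state T ξ x y n).active ∨ p m < p i)
    (hd : Disjoint (interval T (state T ξ x y t) m) (interval T (state T ξ x y t) i)) :
    (state T ξ x y n).obs i = (state T ξ x y t).obs i ∧
      (state T ξ x y n).err i = (state T ξ x y t).err i := by
  induction n, htn using Nat.le_induction with
  | base => exact ⟨rfl, rfl⟩
  | succ n htn ih =>
    have hlen' : 1 < (state T ξ x y n).active.length :=
      hlen.trans_le (active_length_antitone (Nat.le_succ n))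
    have hi' : i ∉ (state T ξ x y n).active := fun h' => hi (mem_active_of_le htn h')
    have hx := h.output n (by omega) m hμ
    obtain ⟨ih1, ih2⟩ := ih (by omega) hlen' (hm.imp_left (mem_active_of_le (Nat.le_succ n)))
    have hne : (state T ξ x y n).order.find? (x n) ≠ some i := by
      by_cases hma : m ∈ (state T ξ x y n).active
      · exact find?_order_ne_of_active hlen' hma hx hi'
      · refine find?_order_ne_of_lcb hlen' hma hx hi' ?_
        have hpm : p m < p i := hm.resolve_left fun h' => hma (mem_active_of_le (Nat.le_succ n) h')
        rw [ih1, ih2]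
        exact (h.accurate n (by omega) m).lcb_le.trans_lt
          ((h.accurate t (by omega) i).lt_lcb (h.accurate t (by omega) m) hpm hd)
    rw [obs_succ, err_succ, if_neg hne, if_neg fun h' => hne h'.1]
    exact ⟨ih1, ih2⟩

/-- While several arms are active, an active arm or an exposed arm has few observations. -/
theorem exists_obs_le_of_one_lt (hμ : ∀ i, μ i ≤ 1) (h : Typical μ p T ξ x y) {Δ : ℝ}
    (hΔ : 0 < Δ) (hgap : ∀ i j, i ≠ j → Δ ≤ |p i - p j|) {n a : ℕ} (hn : n < T)
    (hlen : 1 < (state T ξ x y n).active.length) (ha : (state T ξ x y n).active.length = a)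
    {M : ℝ} (hM : 361 * slotsAbove (state T ξ x y) a n + 32 / Δ ^ 2 * Real.log T ≤ M) :
    ∃ j, (j ∈ (state T ξ x y n).active ∨ Exposed μ (state T ξ x y n).order j) ∧
      ((state T ξ x y n).obs j : ℝ) ≤ M := by
  by_contra! hcon
  have hM0 : 32 / Δ ^ 2 * Real.log T ≤ M := le_trans (by simp) hM
  have hB0 : 0 ≤ 32 / Δ ^ 2 * Real.log T :=
    mul_nonneg (by positivity) (Real.log_natCast_nonneg T)
  have small : ∀ j, M < (state T ξ x y n).obs j →
      0 < (state T ξ x y n).obs j ∧ radius T ((state T ξ x y n).obs j) ≤ Δ / 4 := by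
    intro j hj
    have h0 : 0 < (state T ξ x y n).obs j := by
      have : (0 : ℝ) < (state T ξ x y n).obs j := by linarith
      exact_mod_cast this
    exact ⟨h0, radius_le_of_le hΔ h0 (by linarith)⟩
  obtain ⟨j, hj⟩ : ∃ j, j ∈ (state T ξ x y n).active :=
    List.exists_mem_of_length_pos (by omega)
  have hjM := hcon j (Or.inl hj)
  obtain ⟨hj0, hjr⟩ := small j hjM
  have hn0 : n ≠ 0 := by
    rintro rfl
    exact hj0.ne' rfl
  -- Arm `j` survived the last update, so its interval meets that of some `i`. Both intervals cannot
  -- be short, so `i` has few observations and by assumption is neither active nor exposed.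
  obtain ⟨i, hij, hmeet⟩ : ∃ i, i ≠ j ∧
      ¬ Disjoint (interval T (state T ξ x y n) i) (interval T (state T ξ x y n) j) := by
    obtain ⟨n, rfl⟩ := Nat.exists_eq_succ_of_ne_zero hn0
    have := ((mem_active_succ n j).1 hj).2
    push Not at this
    exact this
  have hiM : ((state T ξ x y n).obs i : ℝ) ≤ M := by
    by_contra hiM
    obtain ⟨hi0, hir⟩ := small i (not_le.1 hiM)
    exact hmeet ((h.accurate n hn i).disjoint (h.accurate n hn j) hi0 hj0 hΔ (hgap i j hij) hir hjr)
  have hi : i ∉ (state T ξ x y n).active := fun hi => absurd hiM (not_le.2 (hcon i (Or.inl hi)))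
  have hiE : ¬ Exposed μ (state T ξ x y n).order i :=
    fun hi => absurd hiM (not_le.2 (hcon i (Or.inr hi)))
  obtain ⟨m, hmi, hm1, hmE⟩ := exists_blocking hμ (mem_order n i) hiE
  have hmM := hcon m (Or.inr hmE)
  obtain ⟨hm0, hmr⟩ := small m hmM
  have hne : m ≠ i := by
    rintro rfl
    exact hiE hmE
  -- If `m` is inactive as well, it is sorted ahead of `i`, so its lower bound is at most `p i`;
  -- being well observed, `m` then has the smaller parameter.
  have hm : m ∈ (state T ξ x y n).active ∨ p m < p i := by
    obtain ⟨rest, ho, hpw, -, hmem⟩ := order_of_one_lt hlen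
    by_cases hma : m ∈ (state T ξ x y n).active
    · exact Or.inl hma
    · right
      rw [ho, List.sublist_append_iff] at hmi
      obtain ⟨l₁, l₂, hl, hl₁, hl₂⟩ := hmi
      have hl₁' : l₁ = [] := by
        cases l₁ with
        | nil => rfl
        | cons b l₁ =>
          simp only [List.cons_append, List.cons.injEq] at hl
          exact absurd (hl₁.subset (by simp [hl.1])) hma
      subst hl₁'
      rw [List.nil_append] at hl
      subst hl
      have hL := List.pairwise_iff_forall_sublist.1 hpw hl₂
      have h1 := ((h.accurate n hn m).le_lcb hm0).trans (hL.trans (h.accurate n hn i).lcb_le)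
      have h2 := EReal.coe_le_coe_iff.1 h1
      have h3 := hgap m i hne
      by_contra hcon'
      rw [abs_of_nonneg (by linarith)] at h3
      linarith
  -- Since its elimination `i` has been hidden behind `m`, so its interval is still the one that was
  -- disjoint from that of `j` at slot `t + 1`.
  obtain ⟨t, htn, hta, hta'⟩ := exists_eliminated hi
  have hd := disjoint_of_eliminated hta hta'
  obtain ⟨ho, he⟩ := state_eq_of_blocked h hn htn hlen hta' hm1 hm (hd m hne)
  have hdj := hd j hij.symm
  have hj0' : 0 < (state T ξ x y (t + 1)).obs j := by
    by_contra h0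
    rw [interval_eq_univ (by omega)] at hdj
    exact Set.disjoint_left.1 hdj (Set.mem_univ _) (h.accurate (t + 1) (by omega) i).mem_interval
  have hσ : t + 1 ≤ slotsAbove (state T ξ x y) a n := by
    refine le_slotsAbove ?_ htn
    rw [← ha]
    exact (active_length_antitone htn).trans_lt (active_length_succ_lt hta hta')
  -- At slot `t + 1` arm `j` had at most `t + 1` observations, and `t + 1` is at most the number of
  -- slots before the current phase.
  have hobs : 361 * (state T ξ x y (t + 1)).obs j ≤ (state T ξ x y n).obs j := by
    have h1 := obs_le (T := T) (ξ := ξ) (x := x) (y := y) (t + 1) j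
    have h2 : ((361 * slotsAbove (state T ξ x y) a n : ℕ) : ℝ) < (state T ξ x y n).obs j := by
      push_cast
      linarith
    have h3 : 361 * slotsAbove (state T ξ x y) a n < (state T ξ x y n).obs j := by
      exact_mod_cast h2
    omega
  have hrad := mul_radius_le (T := T) hj0' hobs
  have hsub : interval T (state T ξ x y n) j ⊆ interval T (state T ξ x y (t + 1)) j := by
    refine ((h.accurate n hn j).interval_subset hj0).trans (subset_trans ?_
      ((h.accurate (t + 1) (by omega) j).subset_interval hj0'))
    exact Set.Icc_subset_Icc (EReal.coe_le_coe_iff.2 (by linarith))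
      (EReal.coe_le_coe_iff.2 (by linarith))
  refine hmeet (Set.disjoint_of_subset_right hsub ?_)
  have : interval T (state T ξ x y n) i = interval T (state T ξ x y (t + 1)) i := by
    unfold interval
    rw [ho, he]
  rw [this]
  exact hdj.symm

theorem exposed_of_active_eq_cons {n : ℕ} (hlen : 1 < (state T ξ x y n).active.length)
    {j : Fin K} {l : List (Fin K)} (h : (state T ξ x y n).active = j :: l) :
    Exposed μ (state T ξ x y n).order j := by
  obtain ⟨rest, ho, -⟩ := order_of_one_lt hlen
  rw [ho, h]
  exact exposed_head _ _ _

/-- While several arms are active, one of the last slots had an exposed arm with few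
observations. -/
theorem exists_exposed_obs_le_of_one_lt (hμ : ∀ i, μ i ≤ 1) (h : Typical μ p T ξ x y) {Δ : ℝ}
    (hΔ : 0 < Δ) (hgap : ∀ i j, i ≠ j → Δ ≤ |p i - p j|) {n a : ℕ} (hn : n < T)
    (hlen : 1 < a) (ha : (state T ξ x y n).active.length = a) :
    ∃ d < K, d ≤ n ∧ (state T ξ x y (n - d)).active.length = a ∧
      ∃ j, Exposed μ (state T ξ x y (n - d)).order j ∧
        ((state T ξ x y (n - d)).obs j : ℝ) ≤ 361 * slotsAbove (state T ξ x y) a (n - d) + K +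
          32 / Δ ^ 2 * Real.log T := by
  have hB0 : 0 ≤ 32 / Δ ^ 2 * Real.log T :=
    mul_nonneg (by positivity) (Real.log_natCast_nonneg T)
  obtain ⟨j, hj, hjM⟩ := exists_obs_le_of_one_lt hμ h hΔ hgap hn (ha ▸ hlen) ha
    (M := 361 * slotsAbove (state T ξ x y) a n + K + 32 / Δ ^ 2 * Real.log T) (by
      have : (0 : ℝ) ≤ K := by positivity
      linarith)
  have hK : 0 < K := j.pos
  rcases hj with hj | hj
  -- If the phase has lasted `K` slots, `j` was at the head during the last `K` slots, with no more
  -- observations than now. Otherwise the slot number itself bounds every count by the start of the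
  -- phase plus `K`, and the current head serves; hence the summand `K`.
  · by_cases hσ : slotsAbove (state T ξ x y) a n + K ≤ n
    · have ha' := slotsAbove_lt ha (by omega)
      obtain ⟨d, hdK, hdn, hlend, l, hl⟩ := exists_eq_cons_active hσ (ha.trans ha'.symm) hj
      refine ⟨d, hdK, hdn, hlend.trans ha, j, exposed_of_active_eq_cons (by omega) hl, ?_⟩
      rw [slotsAbove_eq_of_length_le (Nat.sub_le n d) (hlend.trans ha).le]
      have : (((state T ξ x y (n - d)).obs j : ℕ) : ℝ) ≤ (state T ξ x y n).obs j := by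
        exact_mod_cast obs_mono (T := T) (ξ := ξ) (x := x) (y := y) j (Nat.sub_le n d)
      linarith
    · obtain ⟨k, l, hl⟩ : ∃ k l, (state T ξ x y n).active = k :: l :=
        List.exists_cons_of_length_pos (by omega)
      refine ⟨0, hK, Nat.zero_le n, ha, k, exposed_of_active_eq_cons (by simpa [ha] using hlen) hl, ?_⟩
      have h1 := obs_le (T := T) (ξ := ξ) (x := x) (y := y) n k
      have h2 : (((state T ξ x y n).obs k : ℕ) : ℝ) ≤ (slotsAbove (state T ξ x y) a n + K : ℕ) := by
        exact_mod_cast h1.trans (by omega)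
      push_cast at h2
      have : (0 : ℝ) ≤ slotsAbove (state T ξ x y) a n := by positivity
      simp only [Nat.sub_zero]
      linarith
  · exact ⟨0, hK, Nat.zero_le n, ha, j, hj, hjM⟩

/-- When at most one arm is active and the order is suboptimal, an exposed arm has few
observations. -/
theorem exists_exposed_obs_le_of_le_one (hμ : ∀ i, μ i ≤ 1) (hmono : StrictMono p)
    (h : Typical μ p T ξ x y) {Δ : ℝ}
    (hΔ : 0 < Δ) (hgap : ∀ i j, i ≠ j → Δ ≤ |p i - p j|) {n : ℕ} (hn : n < T)
    (hlen : (state T ξ x y n).active.length ≤ 1)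
    (hr : expectedReward μ p (List.finRange K) -
      expectedReward μ p (state T ξ x y n).order ≠ 0) :
    ∃ j, Exposed μ (state T ξ x y n).order j ∧
      ((state T ξ x y n).obs j : ℝ) ≤ 32 / Δ ^ 2 * Real.log T := by
  obtain ⟨j, i, hj, hji, hlt⟩ := exists_exposed_of_expectedReward_ne hμ (order_perm n) hr
  refine ⟨j, hj, ?_⟩
  by_contra! hcon
  have hB0 : 0 ≤ 32 / Δ ^ 2 * Real.log T :=
    mul_nonneg (by positivity) (Real.log_natCast_nonneg T)
  have hj0 : 0 < (state T ξ x y n).obs j := by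
    have : (0 : ℝ) < (state T ξ x y n).obs j := by linarith
    exact_mod_cast this
  have hjr := radius_le_of_le hΔ hj0 hcon.le
  have hL := List.pairwise_iff_forall_sublist.1 (order_of_le_one hlen) hji
  have h1 := ((h.accurate n hn j).le_lcb hj0).trans (hL.trans (h.accurate n hn i).lcb_le)
  have h2 := EReal.coe_le_coe_iff.1 h1
  have h3 := hgap j i hlt.ne'
  rw [abs_of_pos (sub_pos.2 (hmono hlt))] at h3
  linarith

end Typical

/-! ### Measurability and independence -/

/-- Since there are only countably many states, this makes every function of a state, also jointly
with the outputs of a slot, measurable. -/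
instance stateMeasurableSpace (K : ℕ) : MeasurableSpace (State K) := ⊤

instance stateCountable (K : ℕ) : Countable (State K) := by
  have : Function.Injective fun s : State K => (s.obs, s.err, s.active, s.order) := by
    rintro ⟨a, b, c, d⟩ ⟨a', b', c', d'⟩ h
    simpa using h
  exact this.countable

/-- The states of the algorithm as random variables. -/
abbrev run {Ω : Type*} {K : ℕ} (T : ℕ) (ξ : ℕ → Ω → Equiv.Perm (Fin K))
    (X Y : ℕ → Fin K → Ω → Bool) (ω : Ω) (n : ℕ) : State K :=
  state T (fun m => ξ m ω) (fun m i => X m i ω) (fun m i => Y m i ω) n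

/-- The σ-algebra is arbitrary and only inputs before slot `n` are required, so that the lemma also
applies to `history`. -/
theorem measurable_run {Ω : Type*} [MeasurableSpace Ω] {K : ℕ} (T : ℕ)
    {ξ : ℕ → Ω → Equiv.Perm (Fin K)} {X Y : ℕ → Fin K → Ω → Bool} (n : ℕ)
    (hξ : ∀ n, Measurable (ξ n)) (hX : ∀ m < n, ∀ k, Measurable (X m k))
    (hY : ∀ m < n, ∀ k, Measurable (Y m k)) : Measurable fun ω => run T ξ X Y ω n := by
  induction n with
  | zero =>
    exact (Measurable.of_discrete (f := initial (K := K))).comp (hξ 0)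
  | succ n ih =>
    have ih := ih (fun m hm => hX m (by omega)) (fun m hm => hY m (by omega))
    have h1 : Measurable fun ω => (fun i => X n i ω : Fin K → Bool) :=
      measurable_pi_lambda _ fun i => hX n (by omega) i
    have h2 : Measurable fun ω => (fun i => Y n i ω : Fin K → Bool) :=
      measurable_pi_lambda _ fun i => hY n (by omega) i
    exact (Measurable.of_discrete
      (f := fun z : Equiv.Perm (Fin K) × (Fin K → Bool) × (Fin K → Bool) × State K =>
        step T z.1 z.2.1 z.2.2.1 z.2.2.2)).comp
      ((hξ (n + 1)).prodMk (h1.prodMk (h2.prodMk ih)))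

theorem measurable_slotsAbove {Ω : Type*} [MeasurableSpace Ω] {K : ℕ} {s : Ω → ℕ → State K}
    (a n : ℕ) (hs : ∀ m < n, Measurable fun ω => s ω m) :
    Measurable fun ω => slotsAbove (s ω) a n := by
  simp only [slotsAbove, Finset.card_filter]
  refine Finset.measurable_sum _ fun m hm => ?_
  exact (Measurable.of_discrete (f := fun z : State K => if a < z.active.length then 1 else 0)).comp
    (hs m (Finset.mem_range.1 hm))

/-- The joint law is a product of three laws, and the bracketing of the product does not matter. -/
theorem indepFun_prodMk_left {Ω α β γ : Type*} [MeasurableSpace Ω] [MeasurableSpace α]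
    [MeasurableSpace β] [MeasurableSpace γ] {P : Measure Ω} [IsProbabilityMeasure P]
    {f : Ω → α} {g : Ω → β} {h : Ω → γ} (hf : Measurable f) (hg : Measurable g)
    (hh : Measurable h) (hfgh : IndepFun f (fun ω => (g ω, h ω)) P) (hgh : IndepFun g h P) :
    IndepFun (fun ω => (f ω, g ω)) h P := by
  have hfg : IndepFun f g P := hfgh.comp measurable_id measurable_fst
  rw [indepFun_iff_map_prod_eq_prod_map_map (by fun_prop) (by fun_prop)] at hfgh hgh hfg ⊢
  have := Measure.isProbabilityMeasure_map (μ := P) hf.aemeasurable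
  have := Measure.isProbabilityMeasure_map (μ := P) hg.aemeasurable
  have := Measure.isProbabilityMeasure_map (μ := P) hh.aemeasurable
  rw [hfg]
  apply MeasurableEquiv.prodAssoc.map_measurableEquiv_injective
  rw [Measure.prodAssoc_prod, ← hgh, ← hfgh,
    Measure.map_map MeasurableEquiv.prodAssoc.measurable (by fun_prop)]
  rfl

section Environment

variable {Ω : Type*} {K : ℕ} {X Y : ℕ → Fin K → Ω → Bool} {ξ : ℕ → Ω → Equiv.Perm (Fin K)}

/-- The outputs and the feedback of the arms in `S`. -/
def outcomes (X Y : ℕ → Fin K → Ω → Bool) (S : Finset (ℕ × Fin K)) (ω : Ω) : S → Bool × Bool :=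
  fun a => (X a.1.1 a.1.2 ω, Y a.1.1 a.1.2 ω)

/-- The information given by the internal randomness and the outcomes in `S`. -/
@[reducible]
def history (ξ : ℕ → Ω → Equiv.Perm (Fin K)) (X Y : ℕ → Fin K → Ω → Bool)
    (S : Finset (ℕ × Fin K)) : MeasurableSpace Ω :=
  MeasurableSpace.comap (fun ω => ((fun n => ξ n ω), outcomes X Y S ω)) inferInstance

theorem measurable_history_internal (S : Finset (ℕ × Fin K)) (n : ℕ) :
    Measurable[history ξ X Y S] (ξ n) :=
  ((measurable_pi_apply n).comp measurable_fst).comp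
    (comap_measurable fun ω => ((fun n => ξ n ω), outcomes X Y S ω))

theorem measurable_history_outcome {S : Finset (ℕ × Fin K)} {n : ℕ} {k : Fin K}
    (h : (n, k) ∈ S) : Measurable[history ξ X Y S] fun ω => (X n k ω, Y n k ω) :=
  ((measurable_pi_apply (⟨(n, k), h⟩ : S)).comp measurable_snd).comp
    (comap_measurable fun ω => ((fun n => ξ n ω), outcomes X Y S ω))

theorem measurable_history_output {S : Finset (ℕ × Fin K)} {n : ℕ} {k : Fin K}
    (h : (n, k) ∈ S) : Measurable[history ξ X Y S] (X n k) :=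
  measurable_fst.comp (measurable_history_outcome h)

theorem measurable_history_run (T : ℕ) {S : Finset (ℕ × Fin K)} {n : ℕ}
    (h : ∀ m < n, ∀ k, (m, k) ∈ S) :
    Measurable[history ξ X Y S] fun ω => run T ξ X Y ω n :=
  @measurable_run Ω (history ξ X Y S) K T ξ X Y n (measurable_history_internal S)
    (fun m hm k => measurable_history_output (h m hm k))
    (fun m hm k => measurable_snd.comp (measurable_history_outcome (h m hm k)))

variable [MeasurableSpace Ω] {P : Measure Ω} {μ p : Fin K → ℝ}

theorem measurable_outcomes (hE : IsEnvironment P μ p X Y) (S : Finset (ℕ × Fin K)) :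
    Measurable (outcomes X Y S) :=
  measurable_pi_lambda _ fun _ => (hE.measurable_output _ _).prodMk (hE.measurable_feedback _ _)

theorem history_le (hE : IsEnvironment P μ p X Y) (hξ : ∀ n, Measurable (ξ n))
    (S : Finset (ℕ × Fin K)) : history ξ X Y S ≤ ‹MeasurableSpace Ω› :=
  Measurable.comap_le ((measurable_pi_lambda _ hξ).prodMk (measurable_outcomes hE S))

theorem measurableSet_output (hE : IsEnvironment P μ p X Y) (n : ℕ) (i : Fin K) (b : Bool) :
    MeasurableSet {ω | X n i ω = b} :=
  hE.measurable_output n i (measurableSet_singleton b)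

theorem measurableSet_feedback (hE : IsEnvironment P μ p X Y) (n : ℕ) (i : Fin K) (b : Bool) :
    MeasurableSet {ω | Y n i ω = b} :=
  hE.measurable_feedback n i (measurableSet_singleton b)

variable [IsProbabilityMeasure P]

theorem indep_history (hE : IsEnvironment P μ p X Y) (hξ : ∀ n, Measurable (ξ n))
    (hind : IndepFun (fun ω n => ξ n ω) (fun ω (a : ℕ × Fin K) => (X a.1 a.2 ω, Y a.1 a.2 ω)) P)
    {S S' : Finset (ℕ × Fin K)} (hS : Disjoint S S') :
    Indep (history ξ X Y S) (MeasurableSpace.comap (outcomes X Y S') inferInstance) P := by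
  have h1 : IndepFun (outcomes X Y S) (outcomes X Y S') P :=
    hE.indep.indepFun_finset S S' hS fun a =>
      (hE.measurable_output _ _).prodMk (hE.measurable_feedback _ _)
  have h2 : IndepFun (fun ω n => ξ n ω) (fun ω => (outcomes X Y S ω, outcomes X Y S' ω)) P :=
    hind.comp (ψ := fun w : ℕ × Fin K → Bool × Bool => ((fun a : S => w a, fun a : S' => w a) :
      (S → Bool × Bool) × (S' → Bool × Bool))) measurable_id (by fun_prop)
  exact indepFun_prodMk_left (measurable_pi_lambda _ hξ) (measurable_outcomes hE S)
    (measurable_outcomes hE S') h2 h1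

theorem prob_output_false (hE : IsEnvironment P μ p X Y) (n : ℕ) (i : Fin K) :
    P.real {ω | X n i ω = false} = 1 - μ i := by
  rw [← hE.prob_output n i, ← probReal_compl_eq_one_sub (measurableSet_output hE n i true)]
  congr 1
  ext ω
  simp

/-! ### Exposed arms are shown -/

/-- The probability that arm `j` has an output and all other arms that can fail do fail. -/
def hitProb (μ : Fin K → ℝ) (j : Fin K) : ℝ :=
  ∏ k, if k = j then μ k else if μ k < 1 then 1 - μ k else 1

theorem hitProb_pos (hμ : ∀ i, 0 < μ i) (j : Fin K) : 0 < hitProb μ j := by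
  refine Finset.prod_pos fun k _ => ?_
  split_ifs with h1 h2
  · exact hμ k
  · linarith
  · exact one_pos

/-- Arm `j` has an output and all other arms that can fail do fail. -/
def hit (X : ℕ → Fin K → Ω → Bool) (μ : Fin K → ℝ) (n : ℕ) (j : Fin K) : Set Ω :=
  {ω | X n j ω = true ∧ ∀ k, k ≠ j → μ k < 1 → X n k ω = false}

theorem prob_hit (hE : IsEnvironment P μ p X Y) (n : ℕ) (j : Fin K) :
    P.real (hit X μ n j) = hitProb μ j := by
  have hind : iIndepFun (fun k ω => (X n k ω, Y n k ω)) P :=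
    hE.indep.precomp (g := fun k => (n, k)) fun k k' h => by simpa using h
  let A : Fin K → Set (Bool × Bool) := fun k =>
    {z | if k = j then z.1 = true else if μ k < 1 then z.1 = false else True}
  have h := hind.measure_inter_preimage_eq_mul Finset.univ (sets := A)
    fun k _ => Set.Countable.measurableSet (Set.to_countable _)
  have hset : hit X μ n j = ⋂ k ∈ Finset.univ, (fun ω => (X n k ω, Y n k ω)) ⁻¹' A k := by
    ext ω
    simp only [hit, Set.mem_ofPred_eq, Finset.mem_univ, Set.iInter_true, Set.mem_iInter,
      Set.mem_preimage, A]
    constructor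
    · rintro ⟨h1, h2⟩ k
      split_ifs with hk hk'
      · rw [hk]; exact h1
      · exact h2 k hk hk'
    · intro h
      refine ⟨by simpa using h j, fun k hk hk' => by simpa [hk, hk'] using h k⟩
  rw [hset, measureReal_def, h, ENNReal.toReal_prod, hitProb]
  refine Finset.prod_congr rfl fun k _ => ?_
  rw [← measureReal_def]
  by_cases hk : k = j
  · rw [if_pos hk, ← hE.prob_output n k]
    congr 1
    ext ω
    simp [A, hk]
  · by_cases hk' : μ k < 1
    · rw [if_neg hk, if_pos hk', ← prob_output_false hE n k]
      congr 1
      ext ω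
      simp [A, hk, hk']
    · rw [if_neg hk, if_neg hk', ← probReal_univ (μ := P)]
      congr 1
      ext ω
      simp [A, hk, hk']

/-- The event `A` is decided before slot `n`, whereas `hit` depends on the outputs in slot `n` only.
-/
theorem prob_inter_hit (hE : IsEnvironment P μ p X Y) (hξ : ∀ n, Measurable (ξ n))
    (hind : IndepFun (fun ω n => ξ n ω) (fun ω (a : ℕ × Fin K) => (X a.1 a.2 ω, Y a.1 a.2 ω)) P)
    {n : ℕ} {A : Set Ω} (hA : MeasurableSet[history ξ X Y (Finset.range n ×ˢ Finset.univ)] A)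
    (j : Fin K) : P.real (A ∩ hit X μ n j) = P.real A * hitProb μ j := by
  have hdisj : Disjoint (Finset.range n ×ˢ (Finset.univ : Finset (Fin K)))
      ({n} ×ˢ (Finset.univ : Finset (Fin K))) := by
    rw [Finset.disjoint_left]
    rintro ⟨m, k⟩ h h'
    simp at h h'
    omega
  have hQ : MeasurableSet[MeasurableSpace.comap
      (outcomes X Y ({n} ×ˢ (Finset.univ : Finset (Fin K)))) inferInstance] (hit X μ n j) := by
    have hm : ∀ k : Fin K, (n, k) ∈ ({n} ×ˢ (Finset.univ : Finset (Fin K))) := by simp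
    refine ⟨{w | (w ⟨(n, j), hm j⟩).1 = true ∧ ∀ k, k ≠ j → μ k < 1 →
      (w ⟨(n, k), hm k⟩).1 = false}, Set.Countable.measurableSet (Set.to_countable _), ?_⟩
    ext ω
    simp [hit, outcomes]
  have := (Indep_iff _ _ _).1 (indep_history hE hξ hind hdisj) _ _ hA hQ
  rw [measureReal_def, this, ENNReal.toReal_mul, ← measureReal_def, ← measureReal_def,
    prob_hit hE]

/-- The expected number of slots in which arm `j` is exposed and has at most `M` observations. -/
theorem sum_prob_exposed_le (hE : IsEnvironment P μ p X Y) (hξ : ∀ n, Measurable (ξ n))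
    (hind : IndepFun (fun ω n => ξ n ω) (fun ω (a : ℕ × Fin K) => (X a.1 a.2 ω, Y a.1 a.2 ω)) P)
    (T : ℕ) (j : Fin K) (M : Ω → ℝ) (hM : Integrable M P) (hM0 : ∀ ω, 0 ≤ M ω) (A : ℕ → Set Ω)
    (hA : ∀ n, MeasurableSet[history ξ X Y (Finset.range n ×ˢ Finset.univ)] (A n))
    (hAexp : ∀ n < T, ∀ ω ∈ A n, Exposed μ (run T ξ X Y ω n).order j ∧
      ((run T ξ X Y ω n).obs j : ℝ) ≤ M ω) :
    hitProb μ j * ∑ n ∈ Finset.range T, P.real (A n) ≤ ∫ ω, M ω ∂P + 1 := by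
  have hmA : ∀ n, MeasurableSet (A n) := fun n => history_le hE hξ _ _ (hA n)
  have hmQ : ∀ n, MeasurableSet (hit X μ n j) := by
    intro n
    have : hit X μ n j = {ω | X n j ω = true} ∩
        ⋂ k, ⋂ (_ : k ≠ j), ⋂ (_ : μ k < 1), {ω | X n k ω = false} := by
      ext ω; simp [hit]
    rw [this]
    exact (measurableSet_output hE n j true).inter (MeasurableSet.iInter fun k =>
      MeasurableSet.iInter fun _ => MeasurableSet.iInter fun _ => measurableSet_output hE n k false)
  have hint : ∀ n ∈ Finset.range T,
      Integrable ((A n ∩ hit X μ n j).indicator (1 : Ω → ℝ)) P := fun n _ =>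
    (integrable_const (1 : ℝ)).indicator ((hmA n).inter (hmQ n))
  calc hitProb μ j * ∑ n ∈ Finset.range T, P.real (A n)
      = ∑ n ∈ Finset.range T, P.real (A n ∩ hit X μ n j) := by
        rw [Finset.mul_sum]
        refine Finset.sum_congr rfl fun n _ => ?_
        rw [prob_inter_hit hE hξ hind (hA n), mul_comm]
    _ = ∫ ω, ∑ n ∈ Finset.range T, (A n ∩ hit X μ n j).indicator (1 : Ω → ℝ) ω ∂P := by
        rw [integral_finsetSum _ hint]
        exact Finset.sum_congr rfl fun n _ => (integral_indicator_one ((hmA n).inter (hmQ n))).symm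
    -- Pathwise: on `A n ∩ hit X μ n j` arm `j` is shown while it has at most `M ω` observations,
    -- which happens at most `M ω + 1` times. So `M` may depend on the whole path.
    _ ≤ ∫ ω, (M ω + 1) ∂P := by
        refine integral_mono (integrable_finsetSum _ hint) (hM.add (integrable_const 1)) ?_
        intro ω
        classical
        have := card_shown_le (T := T) (ξ := fun m => ξ m ω) (x := fun m i => X m i ω)
          (y := fun m i => Y m i ω) j (hM0 ω)
          ((Finset.range T).filter fun n => ω ∈ A n ∩ hit X μ n j) (by
            intro n hn
            obtain ⟨hnT, hωA, hωQ⟩ := Finset.mem_filter.1 hn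
            obtain ⟨h1, h2⟩ := hAexp n (Finset.mem_range.1 hnT) ω hωA
            exact ⟨find?_order_of_exposed h1 hωQ.1 hωQ.2, h2⟩)
        refine le_trans (le_of_eq ?_) this
        simp only [Set.indicator_apply, Pi.one_apply]
        rw [Finset.sum_boole]
    _ = ∫ ω, M ω ∂P + 1 := by
        rw [integral_add hM (integrable_const 1)]
        simp

end Environment

/-! ### Concentration of the estimates -/

/-- Hoeffding's lemma for a Bernoulli distribution. -/
theorem bernoulli_hoeffding {q : ℝ} (hq : 0 ≤ q ∧ q ≤ 1) (t : ℝ) :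
    q * Real.exp (t * (1 - q)) + (1 - q) * Real.exp (-(t * q)) ≤ Real.exp (t ^ 2 / 8) := by
  let ν : Measure Bool := ENNReal.ofReal q • Measure.dirac true +
    ENNReal.ofReal (1 - q) • Measure.dirac false
  have hν : IsProbabilityMeasure ν := ⟨by
    simp only [ν, Measure.add_apply, Measure.smul_apply, measure_univ, smul_eq_mul, mul_one]
    rw [← ENNReal.ofReal_add hq.1 (by linarith [hq.2])]
    simp⟩
  have hint : ∀ f : Bool → ℝ, ∫ b, f b ∂ν = q * f true + (1 - q) * f false := by
    intro f
    have := Measure.smul_finite (Measure.dirac true) (ENNReal.ofReal_ne_top (r := q))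
    have := Measure.smul_finite (Measure.dirac false) (ENNReal.ofReal_ne_top (r := 1 - q))
    rw [integral_add_measure .of_finite .of_finite, integral_smul_measure, integral_smul_measure,
      integral_dirac, integral_dirac, ENNReal.toReal_ofReal hq.1,
      ENNReal.toReal_ofReal (by linarith [hq.2])]
    rfl
  let f : Bool → ℝ := fun b => if b then 1 else 0
  have h := (hasSubgaussianMGF_of_mem_Icc (μ := ν) (X := f) (a := 0) (b := 1)
    Measurable.of_discrete.aemeasurable (ae_of_all _ fun b => by cases b <;> simp [f])).mgf_le t
  rw [mgf, hint, hint] at h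
  simp only [f, if_true, Bool.false_eq_true, if_false, mul_one, mul_zero, add_zero] at h
  refine le_trans (le_of_eq ?_) (h.trans (le_of_eq ?_))
  · ring_nf
  · congr 1
    push_cast
    norm_num
    ring

/-- The factor by which an observation changes the exponential supermartingale. -/
def expFactor (t q : ℝ) (z : Bool × Bool) : ENNReal :=
  if z.1 = true then
    ENNReal.ofReal (Real.exp (t * ((if z.2 = false then 1 else 0) - q) - t ^ 2 / 8))
  else 1

/-- The exponential supermartingale for the error count of an arm. -/
def expProcess {K : ℕ} (t : ℝ) (p : Fin K → ℝ) (i : Fin K) (s : State K) : ENNReal :=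
  ENNReal.ofReal (Real.exp (t * (s.err i - p i * s.obs i) - t ^ 2 / 8 * s.obs i))

/-- This separates the event that `i` is shown into its own output and an event that does not
involve that output, so that independence can be used within one slot. -/
theorem find?_eq_some_iff_update {α : Type*} [DecidableEq α] (q : α → Bool) (l : List α) (i : α) :
    l.find? q = some i ↔ q i = true ∧ l.find? (Function.update q i true) = some i := by
  by_cases h : q i = true
  · rw [← h, Function.update_eq_self]
    simp [h]
  · refine ⟨fun h' => absurd (List.find?_some h') h, fun h' => absurd h'.1 h⟩

section Environment

variable {Ω : Type*} {K : ℕ} {μ p : Fin K → ℝ} {X Y : ℕ → Fin K → Ω → Bool} {ξ : ℕ → Ω → Equiv.Perm (Fin K)}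

theorem expProcess_run_succ (T : ℕ) (t : ℝ) (i : Fin K) (n : ℕ) (ω : Ω) :
    expProcess t p i (run T ξ X Y ω (n + 1)) = expProcess t p i (run T ξ X Y ω n) *
      if (run T ξ X Y ω n).order.find? (Function.update (fun k => X n k ω) i true) = some i then
        expFactor t (p i) (X n i ω, Y n i ω) else 1 := by
  unfold expProcess expFactor
  rw [obs_succ, err_succ]
  simp only [find?_eq_some_iff_update (fun k => X n k ω)]
  by_cases h1 : (run T ξ X Y ω n).order.find? (Function.update (fun k => X n k ω) i true) = some i
  · by_cases h2 : X n i ω = true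
    · by_cases h3 : Y n i ω = false
      · simp only [h1, h2, h3, and_self, if_true, Nat.cast_add, Nat.cast_one]
        rw [← ENNReal.ofReal_mul (Real.exp_nonneg _), ← Real.exp_add]
        ring_nf
      · rw [Bool.not_eq_false] at h3
        simp only [h1, h2, h3, and_self, and_false, if_true, if_false, Nat.cast_add,
          Nat.cast_one, add_zero, Bool.true_eq_false]
        rw [← ENNReal.ofReal_mul (Real.exp_nonneg _), ← Real.exp_add]
        ring_nf
    · simp [h1, h2]
  · simp [h1]

variable [MeasurableSpace Ω] {P : Measure Ω}

theorem prob_output_error (hE : IsEnvironment P μ p X Y) (hμ : ∀ i, 0 < μ i) (n : ℕ)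
    (i : Fin K) : P.real {ω | X n i ω = true ∧ Y n i ω = false} = μ i * p i := by
  have h := hE.prob_error n i
  rw [measureReal_def, cond_apply (measurableSet_output hE n i true), ENNReal.toReal_mul,
    ENNReal.toReal_inv, ← measureReal_def, ← measureReal_def, hE.prob_output] at h
  rw [← h, mul_inv_cancel_left₀ (hμ i).ne']
  rfl

variable [IsProbabilityMeasure P]

/-- Without an output the factor is one; given an output the error is Bernoulli with mean `p i`, and
Hoeffding's lemma is compensated by `t ^ 2 / 8`. -/
theorem lintegral_expFactor_le (hE : IsEnvironment P μ p X Y) (hμ : ∀ i, 0 < μ i ∧ μ i ≤ 1)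
    (hp : ∀ i, 0 ≤ p i ∧ p i ≤ 1) (t : ℝ) (n : ℕ) (i : Fin K) :
    ∫⁻ ω, expFactor t (p i) (X n i ω, Y n i ω) ∂P ≤ 1 := by
  have hmX := measurableSet_output hE n i true
  have hmY := measurableSet_feedback hE n i false
  have hW : Measurable fun ω => (X n i ω, Y n i ω) :=
    (hE.measurable_output n i).prodMk (hE.measurable_feedback n i)
  rw [← lintegral_map (f := expFactor t (p i)) Measurable.of_discrete hW, lintegral_fintype]
  have := Measure.isProbabilityMeasure_map (μ := P) hW.aemeasurable
  set ν := P.map fun ω => (X n i ω, Y n i ω)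
  have hν : ∀ z, ν {z} = ENNReal.ofReal (P.real {ω | X n i ω = z.1 ∧ Y n i ω = z.2}) := by
    intro z
    rw [measureReal_def, ENNReal.ofReal_toReal (measure_ne_top _ _),
      Measure.map_apply hW (measurableSet_singleton z)]
    congr 1
    ext ω
    simp [Prod.ext_iff]
  have hTF := prob_output_error hE (fun i => (hμ i).1) n i
  have hTT : P.real {ω | X n i ω = true ∧ Y n i ω = true} = μ i * (1 - p i) := by
    have := measureReal_inter_add_sdiff (μ := P) (s := {ω | X n i ω = true}) hmY
    have h2 : {ω | X n i ω = true} \ {ω | Y n i ω = false} =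
        {ω | X n i ω = true ∧ Y n i ω = true} := by
      ext ω; simp
    rw [h2, hE.prob_output n i, show {ω | X n i ω = true} ∩ {ω | Y n i ω = false} =
      {ω | X n i ω = true ∧ Y n i ω = false} from rfl, hTF] at this
    linarith
  have hF : P.real {ω | X n i ω = false ∧ Y n i ω = true} +
      P.real {ω | X n i ω = false ∧ Y n i ω = false} = 1 - μ i := by
    have := measureReal_inter_add_sdiff (μ := P) (s := {ω | X n i ω = false}) hmY
    have h2 : {ω | X n i ω = false} \ {ω | Y n i ω = false} =
        {ω | X n i ω = false ∧ Y n i ω = true} := by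
      ext ω; simp
    rw [h2, prob_output_false hE n i] at this
    rw [← this, add_comm]
    rfl
  have hmul : ∀ a b : ℝ, ENNReal.ofReal (Real.exp a) * ENNReal.ofReal b =
      ENNReal.ofReal (Real.exp a * b) := fun a b => (ENNReal.ofReal_mul (Real.exp_nonneg a)).symm
  have hq0 := (hμ i).1.le
  have hq1 : 0 ≤ 1 - p i := by linarith [(hp i).2]
  simp only [Fintype.sum_prod_type, Fintype.sum_bool, hν, expFactor, if_true,
    Bool.false_eq_true, if_false, one_mul, Bool.true_eq_false, hmul, hTT, hTF]
  rw [← ENNReal.ofReal_add measureReal_nonneg measureReal_nonneg, hF,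
    ← ENNReal.ofReal_add (by positivity) (mul_nonneg (Real.exp_nonneg _)
      (mul_nonneg hq0 (hp i).1)),
    ← ENNReal.ofReal_add (add_nonneg (by positivity) (mul_nonneg (Real.exp_nonneg _)
      (mul_nonneg hq0 (hp i).1))) (by linarith [(hμ i).2])]
  refine ENNReal.ofReal_le_one.2 ?_
  have hH := bernoulli_hoeffding (hp i) t
  have h1 : Real.exp (t * (0 - p i) - t ^ 2 / 8) =
      Real.exp (-(t * p i)) * Real.exp (-(t ^ 2 / 8)) := by
    rw [← Real.exp_add]; ring_nf
  have h2 : Real.exp (t * (1 - p i) - t ^ 2 / 8) =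
      Real.exp (t * (1 - p i)) * Real.exp (-(t ^ 2 / 8)) := by
    rw [← Real.exp_add]; ring_nf
  have h3 := mul_le_mul_of_nonneg_right hH (Real.exp_nonneg (-(t ^ 2 / 8)))
  rw [← Real.exp_add, add_neg_cancel, Real.exp_zero] at h3
  rw [h1, h2]
  nlinarith

theorem lintegral_expProcess_le (hE : IsEnvironment P μ p X Y) (hξ : ∀ n, Measurable (ξ n))
    (hind : IndepFun (fun ω n => ξ n ω) (fun ω (a : ℕ × Fin K) => (X a.1 a.2 ω, Y a.1 a.2 ω)) P)
    (hμ : ∀ i, 0 < μ i ∧ μ i ≤ 1) (hp : ∀ i, 0 ≤ p i ∧ p i ≤ 1) (T : ℕ) (t : ℝ) (i : Fin K)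
    (n : ℕ) : ∫⁻ ω, expProcess t p i (run T ξ X Y ω n) ∂P ≤ 1 := by
  induction n with
  | zero => simp [expProcess, state, initial]
  | succ n ih =>
    -- All outcomes up to slot `n` except that of arm `i` in slot `n`. They decide the state and
    -- whether the search reaches `i`, and are independent of the omitted outcome.
    let S : Finset (ℕ × Fin K) := (Finset.range (n + 1) ×ˢ Finset.univ).erase (n, i)
    have hdisj : Disjoint S {(n, i)} := by simp [S]
    have hindep := indep_history hE hξ hind hdisj
    have hle := history_le hE hξ S
    have hrun : Measurable[history ξ X Y S] fun ω => run T ξ X Y ω n := by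
      refine measurable_history_run T fun m hm k => ?_
      simp only [S, Finset.mem_erase, Finset.mem_product, Finset.mem_range, Finset.mem_univ,
        and_true, ne_eq, Prod.mk.injEq, not_and]
      omega
    have hupd : Measurable[history ξ X Y S]
        fun ω => (Function.update (fun k => X n k ω) i true : Fin K → Bool) := by
      refine (@measurable_pi_iff Ω (Fin K) (fun _ => Bool) (history ξ X Y S) _ _).2 fun k => ?_
      by_cases hk : k = i
      · subst hk
        simp only [Function.update_self]
        exact measurable_const
      · simp only [Function.update_of_ne hk]
        exact measurable_history_output (by simp [S, hk])
    let R : Set Ω := {ω | (run T ξ X Y ω n).order.find?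
      (Function.update (fun k => X n k ω) i true) = some i}
    have hR : MeasurableSet[history ξ X Y S] R :=
      (hrun.prodMk hupd) (Set.Countable.measurableSet
        (s := {z : State K × (Fin K → Bool) | z.1.order.find? z.2 = some i}) (Set.to_countable _))
    have hZ : Measurable[history ξ X Y S] fun ω => expProcess t p i (run T ξ X Y ω n) :=
      (Measurable.of_discrete (f := expProcess t p i)).comp hrun
    have hW : Measurable[MeasurableSpace.comap (outcomes X Y {(n, i)}) inferInstance]
        fun ω => expFactor t (p i) (X n i ω, Y n i ω) :=
      (Measurable.of_discrete (f := expFactor t (p i))).comp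
        ((measurable_pi_apply (⟨(n, i), by simp⟩ : ({(n, i)} : Finset (ℕ × Fin K)))).comp
          (comap_measurable (outcomes X Y {(n, i)})))
    have hmul := lintegral_mul_eq_lintegral_mul_lintegral_of_independent_measurableSpace hle
      (measurable_outcomes hE _).comap_le hindep (hZ.indicator hR) hW
    have hsplit : ∀ ω, expProcess t p i (run T ξ X Y ω (n + 1)) =
        Rᶜ.indicator (fun ω => expProcess t p i (run T ξ X Y ω n)) ω +
        R.indicator (fun ω => expProcess t p i (run T ξ X Y ω n)) ω *
          expFactor t (p i) (X n i ω, Y n i ω) := by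
      intro ω
      rw [expProcess_run_succ]
      by_cases hω : ω ∈ R
      · rw [if_pos (show _ = _ from hω)]
        simp [hω]
      · rw [if_neg (show ¬ _ = _ from hω)]
        simp [hω]
    calc ∫⁻ ω, expProcess t p i (run T ξ X Y ω (n + 1)) ∂P
        = ∫⁻ ω, Rᶜ.indicator (fun ω => expProcess t p i (run T ξ X Y ω n)) ω ∂P +
          (∫⁻ ω, R.indicator (fun ω => expProcess t p i (run T ξ X Y ω n)) ω ∂P) *
          ∫⁻ ω, expFactor t (p i) (X n i ω, Y n i ω) ∂P := by
          simp_rw [hsplit]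
          rw [lintegral_add_left ((hZ.indicator hR.compl).mono hle le_rfl), hmul]
      _ ≤ ∫⁻ ω, Rᶜ.indicator (fun ω => expProcess t p i (run T ξ X Y ω n)) ω ∂P +
          (∫⁻ ω, R.indicator (fun ω => expProcess t p i (run T ξ X Y ω n)) ω ∂P) * 1 := by
          gcongr
          exact lintegral_expFactor_le hE hμ hp t n i
      _ = ∫⁻ ω, expProcess t p i (run T ξ X Y ω n) ∂P := by
          rw [mul_one, ← lintegral_add_left ((hZ.indicator hR.compl).mono hle le_rfl)]
          refine lintegral_congr fun ω => ?_
          exact congrFun (Set.indicator_compl_add_self R _) ω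
      _ ≤ 1 := ih

theorem prob_deviation_le (hE : IsEnvironment P μ p X Y) (hξ : ∀ n, Measurable (ξ n))
    (hind : IndepFun (fun ω n => ξ n ω) (fun ω (a : ℕ × Fin K) => (X a.1 a.2 ω, Y a.1 a.2 ω)) P)
    (hμ : ∀ i, 0 < μ i ∧ μ i ≤ 1) (hp : ∀ i, 0 ≤ p i ∧ p i ≤ 1) {T : ℕ} (hT : 2 ≤ T) (i : Fin K)
    (n s : ℕ) : P.real {ω | (run T ξ X Y ω n).obs i = s ∧ ¬ Accurate p T (run T ξ X Y ω n) i} ≤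
      2 / (T : ℝ) ^ 3 := by
  have hT0 : (0 : ℝ) < T := by positivity
  have hlog : 0 ≤ Real.log T := Real.log_natCast_nonneg T
  have markov : ∀ t : ℝ, P.real {ω | (T : ℝ) ^ 3 ≤ Real.exp
      (t * ((run T ξ X Y ω n).err i - p i * (run T ξ X Y ω n).obs i) -
        t ^ 2 / 8 * (run T ξ X Y ω n).obs i)} ≤ 1 / (T : ℝ) ^ 3 := by
    intro t
    have h1 := (mul_meas_ge_le_lintegral₀ (μ := P)
      (f := fun ω => expProcess t p i (run T ξ X Y ω n))
      (((Measurable.of_discrete (f := expProcess t p i)).comp (measurable_run T n hξ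
        (fun m _ k => hE.measurable_output m k)
        (fun m _ k => hE.measurable_feedback m k))).aemeasurable)
      (ENNReal.ofReal ((T : ℝ) ^ 3))).trans (lintegral_expProcess_le hE hξ hind hμ hp T t i n)
    have h2 := ENNReal.toReal_mono ENNReal.one_ne_top h1
    rw [ENNReal.toReal_mul, ENNReal.toReal_ofReal (by positivity), ENNReal.toReal_one,
      ← measureReal_def] at h2
    rw [le_div_iff₀ (by positivity), mul_comm]
    refine le_trans (le_of_eq ?_) h2
    congr 2
    ext ω
    exact (ENNReal.ofReal_le_ofReal_iff (Real.exp_nonneg _)).symm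
  set r := radius T s with hr
  -- The parameter `18 / 5 * r = 4 * (9 / 10 * r)` is the optimal one for a deviation of `9 / 10 *
  -- r`. With `r ^ 2 * s = 2 * log T` the exponent is at least `3.24 * log T`, more than the
  -- required `3 * log T`.
  have hsub : {ω | (run T ξ X Y ω n).obs i = s ∧ ¬ Accurate p T (run T ξ X Y ω n) i} ⊆
      {ω | (T : ℝ) ^ 3 ≤ Real.exp
        (18 / 5 * r * ((run T ξ X Y ω n).err i - p i * (run T ξ X Y ω n).obs i) -
          (18 / 5 * r) ^ 2 / 8 * (run T ξ X Y ω n).obs i)} ∪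
      {ω | (T : ℝ) ^ 3 ≤ Real.exp
        (-(18 / 5 * r) * ((run T ξ X Y ω n).err i - p i * (run T ξ X Y ω n).obs i) -
          (-(18 / 5 * r)) ^ 2 / 8 * (run T ξ X Y ω n).obs i)} := by
    rintro ω ⟨hs, hacc⟩
    unfold Accurate at hacc
    push Not at hacc
    rw [hs] at hacc
    obtain ⟨hs0, hdev⟩ := hacc
    have hs0' : (0 : ℝ) < s := by exact_mod_cast hs0
    have hr0 : 0 ≤ r := radius_nonneg T s
    have hrs : r ^ 2 * s = 2 * Real.log T := by
      rw [hr, radius, Real.sq_sqrt (by positivity)]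
      field_simp
    have hT3 : (T : ℝ) ^ 3 = Real.exp (3 * Real.log T) := by
      rw [mul_comm, Real.exp_mul, Real.exp_log hT0]
      norm_cast
    have hEq : ((run T ξ X Y ω n).err i : ℝ) - p i * s =
        (((run T ξ X Y ω n).err i : ℝ) / s - p i) * s := by
      field_simp
    simp only [Set.mem_union, Set.mem_ofPred_eq, hs, hT3, Real.exp_le_exp, hEq]
    rcases lt_abs.1 hdev with h | h
    · left
      have := mul_le_mul_of_nonneg_left h.le (mul_nonneg hr0 hs0'.le)
      nlinarith
    · right
      have := mul_le_mul_of_nonneg_left h.le (mul_nonneg hr0 hs0'.le)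
      nlinarith
  calc _ ≤ _ := measureReal_mono hsub
    _ ≤ _ := measureReal_union_le _ _
    _ ≤ 1 / (T : ℝ) ^ 3 + 1 / (T : ℝ) ^ 3 := add_le_add (markov _) (markov _)
    _ = 2 / (T : ℝ) ^ 3 := by ring

/-- Sample paths are typical with high probability. -/
theorem prob_not_typical_le (hE : IsEnvironment P μ p X Y) (hξ : ∀ n, Measurable (ξ n))
    (hind : IndepFun (fun ω n => ξ n ω) (fun ω (a : ℕ × Fin K) => (X a.1 a.2 ω, Y a.1 a.2 ω)) P)
    (hμ : ∀ i, 0 < μ i ∧ μ i ≤ 1) (hp : ∀ i, 0 ≤ p i ∧ p i ≤ 1) {T : ℕ} (hT : 2 ≤ T) :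
    P.real {ω | ¬ Typical μ p T (fun m => ξ m ω) (fun m i => X m i ω) (fun m i => Y m i ω)} ≤
      2 * K / T := by
  have hT0 : (0 : ℝ) < T := by positivity
  -- Before slot `T` a count is less than `T`, so `T * K * T` events of probability at most `2 / T ^
  -- 3` suffice; the events in the second union are null.
  have hsub : {ω | ¬ Typical μ p T (fun m => ξ m ω) (fun m i => X m i ω) (fun m i => Y m i ω)} ⊆
      (⋃ n ∈ Finset.range T, ⋃ i ∈ (Finset.univ : Finset (Fin K)), ⋃ s ∈ Finset.range T,
        {ω | (run T ξ X Y ω n).obs i = s ∧ ¬ Accurate p T (run T ξ X Y ω n) i}) ∪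
      (⋃ n ∈ Finset.range T, ⋃ i ∈ (Finset.univ : Finset (Fin K)),
        {ω | μ i = 1 ∧ X n i ω = false}) := by
    intro ω hω
    by_contra hcon
    simp only [Set.mem_union, Set.mem_iUnion, Finset.mem_range, Finset.mem_univ, true_and,
      Set.mem_ofPred_eq, not_or, not_exists, exists_prop, not_and, not_not] at hcon
    refine hω ⟨fun n hn i => hcon.1 n hn i _ ((obs_le n i).trans_lt hn) rfl, fun n hn i hi => ?_⟩
    simpa using hcon.2 n hn i hi
  have h1 : P.real (⋃ n ∈ Finset.range T, ⋃ i ∈ (Finset.univ : Finset (Fin K)),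
      ⋃ s ∈ Finset.range T,
        {ω | (run T ξ X Y ω n).obs i = s ∧ ¬ Accurate p T (run T ξ X Y ω n) i}) ≤
      ∑ n ∈ Finset.range T, ∑ i : Fin K, ∑ s ∈ Finset.range T, 2 / (T : ℝ) ^ 3 := by
    refine (measureReal_biUnion_finset_le _ _).trans (Finset.sum_le_sum fun n _ => ?_)
    refine (measureReal_biUnion_finset_le _ _).trans (Finset.sum_le_sum fun i _ => ?_)
    refine (measureReal_biUnion_finset_le _ _).trans (Finset.sum_le_sum fun s _ => ?_)
    exact prob_deviation_le hE hξ hind hμ hp hT i n s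
  have h2 : P.real (⋃ n ∈ Finset.range T, ⋃ i ∈ (Finset.univ : Finset (Fin K)),
      {ω | μ i = 1 ∧ X n i ω = false}) ≤
      ∑ n ∈ Finset.range T, ∑ i : Fin K, (0 : ℝ) := by
    refine (measureReal_biUnion_finset_le _ _).trans (Finset.sum_le_sum fun n _ => ?_)
    refine (measureReal_biUnion_finset_le _ _).trans (Finset.sum_le_sum fun i _ => ?_)
    by_cases hi : μ i = 1
    · have := prob_output_false hE n i
      rw [hi, sub_self] at this
      simp [hi, this]
    · simp [hi]
  calc _ ≤ _ := measureReal_mono hsub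
    _ ≤ _ := measureReal_union_le _ _
    _ ≤ _ := add_le_add h1 h2
    _ = 2 * K / T := by
      simp only [Finset.sum_const, Finset.card_range, Finset.card_univ, Fintype.card_fin,
        nsmul_eq_mul, mul_zero, add_zero]
      field_simp

end Environment

/-! ### The regret bound -/

/-- The expected waiting time until an exposed arm is shown is at most `(hitProb μ j)⁻¹`; this is
the sum of these bounds. -/
def hitSum {K : ℕ} (μ : Fin K → ℝ) : ℝ := ∑ j, (hitProb μ j)⁻¹

theorem hitSum_nonneg {K : ℕ} {μ : Fin K → ℝ} (hμ : ∀ i, 0 < μ i) : 0 ≤ hitSum μ :=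
  Finset.sum_nonneg fun j _ => (inv_pos.2 (hitProb_pos hμ j)).le

section Environment

variable {Ω : Type*} [MeasurableSpace Ω] {P : Measure Ω} {K : ℕ}
  {μ p : Fin K → ℝ} {X Y : ℕ → Fin K → Ω → Bool} {ξ : ℕ → Ω → Equiv.Perm (Fin K)}

/-- The expected number of slots before slot `T` with more than `a` active arms. -/
def expectedSlotsAbove (P : Measure Ω) (ξ : ℕ → Ω → Equiv.Perm (Fin K))
    (X Y : ℕ → Fin K → Ω → Bool) (T a : ℕ) : ℝ :=
  ∫ ω, (slotsAbove (run T ξ X Y ω) a T : ℝ) ∂P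

theorem slotsAbove_le (s : ℕ → State K) (a n : ℕ) : slotsAbove s a n ≤ n :=
  (Finset.card_filter_le _ _).trans_eq (Finset.card_range n)

theorem measurable_env_run (hE : IsEnvironment P μ p X Y) (hξ : ∀ n, Measurable (ξ n))
    (T n : ℕ) : Measurable fun ω => run T ξ X Y ω n :=
  measurable_run T n hξ (fun m _ k => hE.measurable_output m k)
    (fun m _ k => hE.measurable_feedback m k)

theorem expectedSlotsAbove_eq_zero {T a : ℕ} (ha : K ≤ a) :
    expectedSlotsAbove P ξ X Y T a = 0 := by
  have : ∀ ω, slotsAbove (run T ξ X Y ω) a T = 0 := fun ω =>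
    Finset.card_eq_zero.2 (Finset.filter_false_of_mem fun n _ =>
      not_lt.2 ((active_length_le n).trans ha))
  simp [expectedSlotsAbove, this]

variable [IsProbabilityMeasure P]

theorem integrable_slotsAbove (hE : IsEnvironment P μ p X Y) (hξ : ∀ n, Measurable (ξ n))
    (T a : ℕ) : Integrable (fun ω => (slotsAbove (run T ξ X Y ω) a T : ℝ)) P := by
  refine Integrable.of_bound (C := T) (Measurable.aestronglyMeasurable ?_) (ae_of_all _ fun ω => ?_)
  · exact Measurable.of_discrete.comp
      (measurable_slotsAbove a T fun m _ => measurable_env_run hE hξ T m)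
  · rw [Real.norm_of_nonneg (by positivity)]
    exact_mod_cast slotsAbove_le _ a T

theorem expectedSlotsAbove_eq_sum (hE : IsEnvironment P μ p X Y) (hξ : ∀ n, Measurable (ξ n))
    (T a : ℕ) : expectedSlotsAbove P ξ X Y T a =
      ∑ n ∈ Finset.range T, P.real {ω | a < (run T ξ X Y ω n).active.length} := by
  have hm : ∀ n, MeasurableSet {ω | a < (run T ξ X Y ω n).active.length} := fun n =>
    measurable_env_run hE hξ T n
      (Set.Countable.measurableSet (s := {z : State K | a < z.active.length}) (Set.to_countable _))
  unfold expectedSlotsAbove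
  have : ∀ ω, (slotsAbove (run T ξ X Y ω) a T : ℝ) = ∑ n ∈ Finset.range T,
      {ω | a < (run T ξ X Y ω n).active.length}.indicator (1 : Ω → ℝ) ω := by
    intro ω
    simp only [slotsAbove, Set.indicator_apply, Set.mem_ofPred_eq, Pi.one_apply]
    rw [Finset.sum_boole]
  simp_rw [this]
  have hint : ∀ n ∈ Finset.range T, Integrable
      ({ω | a < (run T ξ X Y ω n).active.length}.indicator (1 : Ω → ℝ)) P := fun n _ =>
    (integrable_const (1 : ℝ)).indicator (hm n)
  rw [integral_finsetSum _ hint]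
  exact Finset.sum_congr rfl fun n _ => integral_indicator_one (hm n)

/-- The expected number of slots in which the number of active arms satisfies `Q` and some exposed
arm has at most `m` observations. -/
theorem sum_prob_exists_exposed_le (hE : IsEnvironment P μ p X Y) (hξ : ∀ n, Measurable (ξ n))
    (hind : IndepFun (fun ω n => ξ n ω) (fun ω (a : ℕ × Fin K) => (X a.1 a.2 ω, Y a.1 a.2 ω)) P)
    (hμ : ∀ i, 0 < μ i) (T : ℕ) (Q : ℕ → Prop) (m : ℕ → Ω → ℝ)
    (hm : ∀ n, Measurable[history ξ X Y (Finset.range n ×ˢ Finset.univ)] (m n))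
    (M : Ω → ℝ) (hM : Integrable M P) (hM0 : ∀ ω, 0 ≤ M ω)
    (hmM : ∀ n < T, ∀ ω, Q (run T ξ X Y ω n).active.length → m n ω ≤ M ω) :
    ∑ n ∈ Finset.range T, P.real {ω | Q (run T ξ X Y ω n).active.length ∧
      ∃ j, Exposed μ (run T ξ X Y ω n).order j ∧ ((run T ξ X Y ω n).obs j : ℝ) ≤ m n ω} ≤
      hitSum μ * (∫ ω, M ω ∂P + 1) := by
  let A : Fin K → ℕ → Set Ω := fun j n => {ω | (Q (run T ξ X Y ω n).active.length ∧
    Exposed μ (run T ξ X Y ω n).order j) ∧ ((run T ξ X Y ω n).obs j : ℝ) ≤ m n ω}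
  have hA : ∀ j n, MeasurableSet[history ξ X Y (Finset.range n ×ˢ Finset.univ)] (A j n) := by
    intro j n
    have hrun : Measurable[history ξ X Y (Finset.range n ×ˢ Finset.univ)]
        fun ω => run T ξ X Y ω n :=
      measurable_history_run T fun k hk i => by simp [hk]
    refine MeasurableSet.inter (hrun (Set.Countable.measurableSet
      (s := {z : State K | Q z.active.length ∧ Exposed μ z.order j}) (Set.to_countable _))) ?_
    exact measurableSet_le
      ((Measurable.of_discrete (f := fun z : State K => (z.obs j : ℝ))).comp hrun) (hm n)
  have hj : ∀ j, ∑ n ∈ Finset.range T, P.real (A j n) ≤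
      (hitProb μ j)⁻¹ * (∫ ω, M ω ∂P + 1) := by
    intro j
    rw [inv_mul_eq_div, le_div_iff₀ (hitProb_pos hμ j), mul_comm]
    exact sum_prob_exposed_le hE hξ hind T j M hM hM0 (A j) (hA j)
      fun n hn ω hω => ⟨hω.1.2, hω.2.trans (hmM n hn ω hω.1.1)⟩
  calc _ ≤ ∑ n ∈ Finset.range T, ∑ j, P.real (A j n) := by
        refine Finset.sum_le_sum fun n _ => ?_
        refine (measureReal_mono (μ := P) (s₂ := ⋃ j ∈ (Finset.univ : Finset (Fin K)), A j n)
          ?_ (measure_ne_top _ _)).trans (measureReal_biUnion_finset_le _ _)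
        rintro ω ⟨hQ, j, hj, hjm⟩
        exact Set.mem_iUnion₂.2 ⟨j, Finset.mem_univ j, ⟨hQ, hj⟩, hjm⟩
    _ = ∑ j, ∑ n ∈ Finset.range T, P.real (A j n) := Finset.sum_comm
    _ ≤ ∑ j, (hitProb μ j)⁻¹ * (∫ ω, M ω ∂P + 1) := Finset.sum_le_sum fun j _ => hj j
    _ = hitSum μ * (∫ ω, M ω ∂P + 1) := by rw [hitSum, Finset.sum_mul]

/-- The expected duration of the phase with exactly `a` active arms. -/
theorem sum_prob_active_length_eq_le (hE : IsEnvironment P μ p X Y) (hξ : ∀ n, Measurable (ξ n))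
    (hind : IndepFun (fun ω n => ξ n ω) (fun ω (a : ℕ × Fin K) => (X a.1 a.2 ω, Y a.1 a.2 ω)) P)
    (hμ : ∀ i, 0 < μ i ∧ μ i ≤ 1) (hp : ∀ i, 0 ≤ p i ∧ p i ≤ 1) {Δ : ℝ} (hΔ : 0 < Δ)
    (hgap : ∀ i j, i ≠ j → Δ ≤ |p i - p j|) {T : ℕ} (hT : 2 ≤ T) {a : ℕ} (ha : 1 < a) :
    ∑ n ∈ Finset.range T, P.real {ω | (run T ξ X Y ω n).active.length = a} ≤
      2 * K + K * (hitSum μ * (361 * expectedSlotsAbove P ξ X Y T a + K +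
        32 / Δ ^ 2 * Real.log T + 1)) := by
  have hT0 : (0 : ℝ) < T := by positivity
  have hB0 : 0 ≤ 32 / Δ ^ 2 * Real.log T :=
    mul_nonneg (by positivity) (Real.log_natCast_nonneg T)
  let m : ℕ → Ω → ℝ := fun n ω =>
    361 * slotsAbove (run T ξ X Y ω) a n + (K + 32 / Δ ^ 2 * Real.log T)
  let E : ℕ → Set Ω := fun n => {ω | (run T ξ X Y ω n).active.length = a ∧
      ∃ j, Exposed μ (run T ξ X Y ω n).order j ∧ ((run T ξ X Y ω n).obs j : ℝ) ≤ m n ω}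
  have hM : Integrable (m T) P :=
    ((integrable_slotsAbove hE hξ T a).const_mul 361).add (integrable_const _)
  -- The threshold `m n` is known before slot `n`, as independence demands, and during the phase it
  -- coincides with the fixed random variable `m T`.
  have hsum : ∑ n ∈ Finset.range T, P.real (E n) ≤ hitSum μ * (∫ ω, m T ω ∂P + 1) := by
    refine sum_prob_exists_exposed_le hE hξ hind (fun i => (hμ i).1) T (fun k => k = a) m
      (fun n => ?_) (m T) hM (fun ω => ?_) (fun n hn ω hω => ?_)
    · refine (Measurable.of_discrete
        (f := fun k : ℕ => 361 * (k : ℝ) + (K + 32 / Δ ^ 2 * Real.log T))).comp ?_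
      exact @measurable_slotsAbove Ω (history ξ X Y (Finset.range n ×ˢ Finset.univ)) K
        (run T ξ X Y) a n fun k hk => measurable_history_run T fun l hl i => by
          simp [hl.trans hk]
    · positivity
    · simp only [m]
      rw [slotsAbove_eq_of_length_le hn.le hω.le]
  have hint : ∫ ω, m T ω ∂P =
      361 * expectedSlotsAbove P ξ X Y T a + K + 32 / Δ ^ 2 * Real.log T := by
    simp only [m]
    rw [integral_add ((integrable_slotsAbove hE hξ T a).const_mul 361)
      (integrable_const _), integral_const_mul]
    simp [expectedSlotsAbove, add_assoc]
  rw [hint] at hsum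
  set D := {ω | ¬ Typical μ p T (fun m => ξ m ω) (fun m i => X m i ω) (fun m i => Y m i ω)}
    with hD
  have hTD : T * P.real D ≤ 2 * K := by
    have := prob_not_typical_le hE hξ hind hμ hp hT
    rwa [le_div_iff₀' hT0] at this
  -- A slot of the phase is charged to one of the last `K` slots including itself; for a fixed delay
  -- `d` no slot is charged twice.
  have hshift : ∀ d, ∑ n ∈ Finset.range T, (if d ≤ n then P.real (E (n - d)) else 0) ≤
      ∑ n ∈ Finset.range T, P.real (E n) := by
    intro d
    rw [← Finset.sum_filter]
    have hinj : Set.InjOn (fun n => n - d) ((Finset.range T).filter fun n => d ≤ n) := by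
      intro k hk l hl hkl
      simp only [Finset.coe_filter, Finset.mem_range, Set.mem_ofPred_eq] at hk hl hkl
      omega
    rw [← Finset.sum_image (f := fun n => P.real (E n)) hinj]
    refine Finset.sum_le_sum_of_subset_of_nonneg (fun k hk => ?_)
      fun _ _ _ => measureReal_nonneg
    obtain ⟨l, hl, rfl⟩ := Finset.mem_image.1 hk
    simp only [Finset.mem_filter, Finset.mem_range] at hl ⊢
    omega
  calc ∑ n ∈ Finset.range T, P.real {ω | (run T ξ X Y ω n).active.length = a}
      ≤ ∑ n ∈ Finset.range T, (P.real D + ∑ d ∈ Finset.range K,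
          if d ≤ n then P.real (E (n - d)) else 0) := by
        refine Finset.sum_le_sum fun n hn => ?_
        have hsub : {ω | (run T ξ X Y ω n).active.length = a} ⊆
            D ∪ ⋃ d ∈ Finset.range K, if d ≤ n then E (n - d) else ∅ := by
          intro ω hω
          by_cases hω' : ω ∈ D
          · exact Or.inl hω'
          · right
            obtain ⟨d, hdK, hdn, hlen, j, hj, hjm⟩ := exists_exposed_obs_le_of_one_lt
              (fun i => (hμ i).2) (not_not.1 hω') hΔ hgap (Finset.mem_range.1 hn) ha hω
            refine Set.mem_iUnion₂.2 ⟨d, Finset.mem_range.2 hdK, ?_⟩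
            rw [if_pos hdn]
            exact ⟨hlen, j, hj, hjm.trans_eq (add_assoc _ _ _)⟩
        refine (measureReal_mono hsub).trans ((measureReal_union_le _ _).trans ?_)
        gcongr
        refine (measureReal_biUnion_finset_le _ _).trans (Finset.sum_le_sum fun d _ => ?_)
        split_ifs <;> simp
    _ = T * P.real D + ∑ d ∈ Finset.range K, ∑ n ∈ Finset.range T,
          (if d ≤ n then P.real (E (n - d)) else 0) := by
        rw [Finset.sum_add_distrib, Finset.sum_comm]
        simp
    _ ≤ 2 * K + ∑ d ∈ Finset.range K, ∑ n ∈ Finset.range T, P.real (E n) :=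
        add_le_add hTD (Finset.sum_le_sum fun d _ => hshift d)
    _ = 2 * K + K * ∑ n ∈ Finset.range T, P.real (E n) := by
        rw [Finset.sum_const, Finset.card_range, nsmul_eq_mul]
    _ ≤ _ := by gcongr

theorem expectedSlotsAbove_succ_le (hE : IsEnvironment P μ p X Y) (hξ : ∀ n, Measurable (ξ n))
    (T a : ℕ) : expectedSlotsAbove P ξ X Y T a ≤ expectedSlotsAbove P ξ X Y T (a + 1) +
      ∑ n ∈ Finset.range T, P.real {ω | (run T ξ X Y ω n).active.length = a + 1} := by
  rw [expectedSlotsAbove_eq_sum hE hξ, expectedSlotsAbove_eq_sum hE hξ, ← Finset.sum_add_distrib]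
  refine Finset.sum_le_sum fun n _ => (measureReal_mono ?_).trans (measureReal_union_le _ _)
  intro ω hω
  simp only [Set.mem_ofPred_eq, Set.mem_union] at hω ⊢
  omega

/-- Suboptimal orderings after the elimination phase. -/
theorem sum_prob_suboptimal_le (hE : IsEnvironment P μ p X Y) (hξ : ∀ n, Measurable (ξ n))
    (hind : IndepFun (fun ω n => ξ n ω) (fun ω (a : ℕ × Fin K) => (X a.1 a.2 ω, Y a.1 a.2 ω)) P)
    (hμ : ∀ i, 0 < μ i ∧ μ i ≤ 1) (hp : ∀ i, 0 ≤ p i ∧ p i ≤ 1) (hmono : StrictMono p) {Δ : ℝ}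
    (hΔ : 0 < Δ) (hgap : ∀ i j, i ≠ j → Δ ≤ |p i - p j|) {T : ℕ} (hT : 2 ≤ T) :
    ∑ n ∈ Finset.range T, P.real {ω | (run T ξ X Y ω n).active.length ≤ 1 ∧
      expectedReward μ p (List.finRange K) -
        expectedReward μ p (run T ξ X Y ω n).order ≠ 0} ≤
      2 * K + hitSum μ * (32 / Δ ^ 2 * Real.log T + 1) := by
  have hT0 : (0 : ℝ) < T := by positivity
  have hB0 : 0 ≤ 32 / Δ ^ 2 * Real.log T :=
    mul_nonneg (by positivity) (Real.log_natCast_nonneg T)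
  set D := {ω | ¬ Typical μ p T (fun m => ξ m ω) (fun m i => X m i ω) (fun m i => Y m i ω)}
    with hD
  have hTD : T * P.real D ≤ 2 * K := by
    have := prob_not_typical_le hE hξ hind hμ hp hT
    rwa [le_div_iff₀' hT0] at this
  have hsum := sum_prob_exists_exposed_le hE hξ hind (fun i => (hμ i).1) T (fun _ => True)
    (fun _ _ => 32 / Δ ^ 2 * Real.log T) (fun _ => measurable_const)
    (fun _ => 32 / Δ ^ 2 * Real.log T) (integrable_const _) (fun _ => hB0)
    (fun _ _ _ _ => le_rfl)
  rw [integral_const, probReal_univ, one_smul] at hsum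
  calc _ ≤ ∑ n ∈ Finset.range T, (P.real D + P.real {ω | True ∧
          ∃ j, Exposed μ (run T ξ X Y ω n).order j ∧
            ((run T ξ X Y ω n).obs j : ℝ) ≤ 32 / Δ ^ 2 * Real.log T}) := by
        refine Finset.sum_le_sum fun n hn =>
          (measureReal_mono ?_).trans (measureReal_union_le _ _)
        rintro ω ⟨hlen, hne⟩
        by_cases hω' : ω ∈ D
        · exact Or.inl hω'
        · exact Or.inr ⟨trivial, exists_exposed_obs_le_of_le_one (fun i => (hμ i).2) hmono
            (not_not.1 hω') hΔ hgap (Finset.mem_range.1 hn) hlen hne⟩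
    _ ≤ _ := by
        rw [Finset.sum_add_distrib, Finset.sum_const, Finset.card_range, nsmul_eq_mul]
        exact add_le_add hTD hsum

theorem abs_regret_le (hμ : ∀ i, 0 < μ i ∧ μ i ≤ 1) (hp : ∀ i, 0 ≤ p i ∧ p i ≤ 1)
    (hE : IsEnvironment P μ p X Y) (hξ : ∀ n, Measurable (ξ n)) (T : ℕ) :
    |regret P μ p ξ X Y T| ≤ expectedSlotsAbove P ξ X Y T 1 +
      ∑ n ∈ Finset.range T, P.real {ω | (run T ξ X Y ω n).active.length ≤ 1 ∧
      expectedReward μ p (List.finRange K) -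
        expectedReward μ p (run T ξ X Y ω n).order ≠ 0} := by
  rw [expectedSlotsAbove_eq_sum hE hξ, ← Finset.sum_add_distrib]
  refine (Finset.abs_sum_le_sum_abs _ _).trans (Finset.sum_le_sum fun n _ => ?_)
  let B : Set Ω := {ω | expectedReward μ p (List.finRange K) -
    expectedReward μ p (run T ξ X Y ω n).order ≠ 0}
  have hB : MeasurableSet B := measurable_env_run hE hξ T n (Set.Countable.measurableSet
    (s := {z : State K | expectedReward μ p (List.finRange K) -
      expectedReward μ p z.order ≠ 0}) (Set.to_countable _))
  calc |∫ ω, (expectedReward μ p (List.finRange K) -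
          expectedReward μ p (run T ξ X Y ω n).order) ∂P|
      ≤ ∫ ω, B.indicator (1 : Ω → ℝ) ω ∂P := by
        rw [← Real.norm_eq_abs]
        refine norm_integral_le_of_norm_le ((integrable_const (1 : ℝ)).indicator hB)
          (ae_of_all _ fun ω => ?_)
        by_cases hω : ω ∈ B
        · rw [Set.indicator_of_mem hω, Pi.one_apply, Real.norm_eq_abs, abs_le]
          have h1 := expectedReward_mem_Icc hμ hp (List.finRange K)
          have h2 := expectedReward_mem_Icc hμ hp (run T ξ X Y ω n).order
          exact ⟨by linarith [h1.1, h2.2], by linarith [h1.2, h2.1]⟩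
        · rw [Set.indicator_of_notMem hω, show expectedReward μ p (List.finRange K) -
            expectedReward μ p (run T ξ X Y ω n).order = 0 from not_not.1 hω, norm_zero]
    _ = P.real B := integral_indicator_one hB
    _ ≤ _ := by
        refine (measureReal_mono ?_).trans (measureReal_union_le _ _)
        intro ω hω
        rcases lt_or_ge 1 (run T ξ X Y ω n).active.length with h | h
        · exact Or.inl h
        · exact Or.inr ⟨h, hω⟩

end Environment

/-- All sufficiently small `Δ > 0` work, as there are finitely many pairs; no minimum is taken, so
there may be no pairs at all. -/
theorem exists_gap {K : ℕ} {p : Fin K → ℝ} (hp : Function.Injective p) :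
    ∃ Δ : ℝ, 0 < Δ ∧ ∀ i j, i ≠ j → Δ ≤ |p i - p j| := by
  have h : ∀ᶠ Δ : ℝ in nhdsWithin 0 (Set.Ioi 0), ∀ i j, i ≠ j → Δ ≤ |p i - p j| := by
    refine Filter.eventually_all.2 fun i => Filter.eventually_all.2 fun j => ?_
    by_cases hij : i = j
    · exact Filter.Eventually.of_forall fun _ h => absurd hij h
    · filter_upwards [Ioo_mem_nhdsGT (abs_pos.2 (sub_ne_zero.2 (hp.ne hij)))] with Δ hΔ _
      exact hΔ.2.le
  exact (Filter.Eventually.and (f := nhdsWithin 0 (Set.Ioi 0)) self_mem_nhdsWithin h).exists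

/-- The constants in the bounds for the durations of the elimination phases. -/
def phaseConst (α β : ℝ) : ℕ → ℝ
  | 0 => 0
  | k + 1 => α * phaseConst α β k + β

end

end CascadeBandit

theorem theorem4 (K : ℕ) (μ p : Fin K → ℝ)
    (hμ : ∀ i, 0 < μ i ∧ μ i ≤ 1)
    (hp : ∀ i, 0 ≤ p i ∧ p i ≤ 1)
    (hmono : StrictMono p) :
    ∃ C : ℝ, ∀ (Ω : Type*) [MeasurableSpace Ω] (P : Measure Ω) [IsProbabilityMeasure P]
      (X Y : ℕ → Fin K → Ω → Bool) (ξ : ℕ → Ω → Equiv.Perm (Fin K)),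
      CascadeBandit.IsEnvironment P μ p X Y →
      (∀ n, Measurable (ξ n)) →
      IndepFun (fun ω n => ξ n ω) (fun ω (a : ℕ × Fin K) => (X a.1 a.2 ω, Y a.1 a.2 ω)) P →
      ∀ T : ℕ, 2 ≤ T → |CascadeBandit.regret P μ p ξ X Y T| ≤ C * Real.log T := by
  obtain ⟨Δ, hΔ, hgap⟩ := CascadeBandit.exists_gap hmono.injective
  set H := CascadeBandit.hitSum μ with hH
  have hH0 : 0 ≤ H := CascadeBandit.hitSum_nonneg fun i => (hμ i).1
  have hK0 : (0 : ℝ) ≤ K := by positivity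
  -- Passing from `a + 1` to `a` adds the length of the phase with `a + 1` arms, which is at most `K
  -- * H * 361` times the expected time before it, plus terms that `β * log T` absorbs.
  set α : ℝ := 1 + K * H * 361 with hα
  set β : ℝ := 4 * K + K * H * (2 * K + 32 / Δ ^ 2 + 2) with hβ
  refine ⟨CascadeBandit.phaseConst α β K + (4 * K + H * (32 / Δ ^ 2 + 2)), ?_⟩
  intro Ω _ P _ X Y ξ hE hξ hind T hT
  have hT2 : (2 : ℝ) ≤ T := by exact_mod_cast hT
  -- Additive constants are turned into multiples of `log T` at the price of a factor two; this uses
  -- `T ≥ 2`.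
  have hlog : 1 ≤ 2 * Real.log T := by
    have := Real.log_le_log two_pos hT2
    linarith [Real.log_two_gt_d9]
  -- Induction on the distance of `a` from `K`: there are never more than `K` active arms, so the
  -- base case is zero.
  have hphase : ∀ k a, K ≤ a + k → 1 ≤ a →
      CascadeBandit.expectedSlotsAbove P ξ X Y T a ≤
        CascadeBandit.phaseConst α β k * Real.log T := by
    intro k
    induction k with
    | zero =>
      intro a ha _
      rw [CascadeBandit.expectedSlotsAbove_eq_zero (by omega)]
      simp [CascadeBandit.phaseConst]
    | succ k ih =>
      intro a ha ha1
      have h1 := CascadeBandit.expectedSlotsAbove_succ_le hE hξ T a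
      have h2 := CascadeBandit.sum_prob_active_length_eq_le hE hξ hind hμ hp hΔ hgap hT
        (a := a + 1) (by omega)
      have h3 := ih (a + 1) (by omega) (by omega)
      set W := CascadeBandit.expectedSlotsAbove P ξ X Y T (a + 1)
      have hKH : 0 ≤ K * H := mul_nonneg hK0 hH0
      calc CascadeBandit.expectedSlotsAbove P ξ X Y T a
          ≤ α * W + (2 * K + K * H * (K + 32 / Δ ^ 2 * Real.log T + 1)) := by
            rw [hα]
            linarith
        _ ≤ α * (CascadeBandit.phaseConst α β k * Real.log T) + β * Real.log T := by
            gcongr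
            rw [hβ]
            nlinarith [mul_le_mul_of_nonneg_left hlog hK0, mul_le_mul_of_nonneg_left hlog hKH,
              mul_le_mul_of_nonneg_left hlog (mul_nonneg hKH hK0)]
        _ = CascadeBandit.phaseConst α β (k + 1) * Real.log T := by
            rw [CascadeBandit.phaseConst]
            ring
  have h1 := CascadeBandit.abs_regret_le hμ hp hE hξ T
  have h2 := hphase K 1 (by omega) le_rfl
  have h3 := CascadeBandit.sum_prob_suboptimal_le hE hξ hind hμ hp hmono hΔ hgap hT
  have h4 : 2 * K + H * (32 / Δ ^ 2 * Real.log T + 1) ≤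
      (4 * K + H * (32 / Δ ^ 2 + 2)) * Real.log T := by
    nlinarith [mul_le_mul_of_nonneg_left hlog hK0, mul_le_mul_of_nonneg_left hlog hH0]
  linarith
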